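/- Let $m,r\ge 1$, let $P(\lambda)=\sum_{j=0}^m\lambda^jA_j$ with $A_j\in\mathbb C^{n\times n}$ and $\operatorname{rank}(A_m)=n$, and let $\mathbb S=\{\lambda_1,\dots,\lambda_s\}$ be a finite set of complex numbers. Define $$\tau_r(\mathbb S):=\inf\Big\{\|\Delta\|_2 \;:\; \Delta\in\mathbb C^{n\times n},\ \sum_{j=1}^s m_j(P+\Delta)\ge r\Big\}\in[0,\infty],$$ where $m_j(P+\Delta)$ is the multiplicity of $\lambda_j$ as a root of $\det(P(\lambda)+\Delta)$ and $\|\cdot\|_2$ is the spectral norm. For $\mu\in\mathbb C^r$ and $\Gamma=(\gamma_{i\ell})_{1\le \ell<i\le r}\in\mathbb C^{r(r-1)/2}$ let $C(\mu,\Gamma)\in\mathbb C^{r\times r}$ be the upper triangular matrix with diagonal $\mu_1,\dots,\mu_r$ and entry $\gamma_{i\ell}$ in row $\ell$ and column $i$ for $\ell<i$, and put $$\mathcal Q(\mu,\Gamma,P):=\sum_{j=0}^m\big(C(\mu,\Gamma)^j\big)^T\otimes A_j\in\mathbb C^{nr\times nr}.$$ Let $P[x_0,\dots,x_k]$ be the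 (entrywise) divided difference of $P$: $P[x_0]=P(x_0)$; if equal nodes are adjacent, it is $\frac{P[x_1,\dots,x_k]-P[x_0,\dots,x_{k-1}]}{x_k-x_0}$ when $x_0\ne x_k$ and $P^{(k)}(x_0)/k!$ when $x_0=x_k$; for other orderings of the nodes it is extended by the same recursion applied to two distinct nodes (so that it is symmetric in the nodes). Let $\sigma_{-k}(M)$ denote the $k$-th smallest singular value of $M$, counted with multiplicity. (1) For all $\mu\in\mathbb C^r$ and all $\Gamma$, the matrix $\mathcal Q(\mu,\Gamma,P)$ is block lower triangular, and its $n\times n$ block in block row $i$ and block column $\ell$ is $$\begin{cases}\displaystyle\sum_{(s_0,\dots,s_k)}\gamma_{s_1s_0}\gamma_{s_2s_1}\cdots\gamma_{s_ks_{k-1}}\,P[\mu_{s_0},\dots,\mu_{s_k}] & i>\ell,\\ P(\mu_i)& i=\ell,\\ 0& i<\ell,\end{cases}$$ where the sum is over all increasing sequences of integers with $s_0=\ell$ and $s_k=i$. (2) Suppose that $\mu\in\mathbb S^r$ attains the minimum over $\mathbb S^r$ of $\kappa_r(\nu):=\sup_{\Gamma}\sigma_{-r}(\mathcal Q(\nu,\Gamma,P))$;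 that, if $r>n$ or if $P[\mu_k,\mu_\ell]$ is singular for some $k<\ell$, the supremum $\kappa_r(\mu)$ is attained; and that, if this supremum is attained, it is attained at some $\Gamma_*$ satisfying * (multiplicity assumption) the singular value $\sigma_{-r}(\mathcal Q(\mu,\Gamma_*,P))$ has multiplicity one; * (linear independence assumption) there are matrices $\mathcal U,\mathcal V\in\mathbb C^{n\times r}$ such that $\operatorname{vec}(\mathcal U),\operatorname{vec}(\mathcal V)$ is a consistent pair of unit left and right singular vectors for this singular value and $\operatorname{rank}(\mathcal V)=r$. (Consistent means $\mathcal Q\operatorname{vec}(\mathcal V)=\sigma\operatorname{vec}(\mathcal U)$ and $\operatorname{vec}(\mathcal U)^*\mathcal Q=\sigma\operatorname{vec}(\mathcal V)^*$, with $\mathcal Q=\mathcal Q(\mu,\Gamma_*,P)$ and $\sigma=\sigma_{-r}(\mathcal Q)$; $\operatorname{vec}$ stacks the columns.) Then $$\tau_r(\mathbb S)=\inf_{\nu\in\mathbb S^r}\ \sup_{\Gamma\in\mathbb C^{r(r-1)/2}}\ \sigma_{-r}\big(\mathcal Q(\nu,\Gamma,P)\big).$$ -/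

import Mathlib

open scoped ENNReal Matrix Kronecker Polynomial

noncomputable section

namespace MatPoly

/-! ### Singular values -/

/-- The singular values `σ 0 ≥ σ 1 ≥ …` of a square complex matrix, with multiplicity. -/
def sv {ι : Type*} [Fintype ι] [DecidableEq ι] (M : Matrix ι ι ℂ) (i : ℕ) : ℝ :=
  (Matrix.toEuclideanLin M).singularValues i

/-- `σ₋ₖ(M)`: the `k`-th smallest singular value of a square matrix (`1 ≤ k ≤ card ι`). -/
def svSmallest {ι : Type*} [Fintype ι] [DecidableEq ι] (k : ℕ) (M : Matrix ι ι ℂ) : ℝ :=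
  sv M (Fintype.card ι - k)

/-- The multiplicity of `x` among the `card ι` singular values of `M`. -/
def svMultiplicity {ι : Type*} [Fintype ι] [DecidableEq ι] (M : Matrix ι ι ℂ) (x : ℝ) : ℕ :=
  Set.ncard {i : ℕ | i < Fintype.card ι ∧ sv M i = x}

/-- The spectral norm `‖Δ‖₂`. -/
def specNorm {n : ℕ} (Δ : Matrix (Fin n) (Fin n) ℂ) : ℝ :=
  ‖Matrix.toEuclideanCLM (𝕜 := ℂ) Δ‖

/-! ### Divided differences -/

/-- The divided difference `f[x₀, …, xₖ]`.  The first and the last case are the usual recursion for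
nodes in which equal nodes are adjacent (then `x₀ = xₖ` forces all nodes to be equal, and the middle
case never occurs).  The middle case extends it to arbitrarily ordered nodes: when `x₀ = xₖ` but
some `xᵢ ≠ x₀`, the same recursion is applied to the pair of distinct nodes `x₀`, `xᵢ`, that is
`f[x₀, …, xₖ] = (f[all but x₀] - f[all but xᵢ]) / (xᵢ - x₀)`. -/
def dividedDiff (f : ℂ → ℂ) : (k : ℕ) → (Fin (k + 1) → ℂ) → ℂ
  | 0, x => f (x 0)
  | k + 1, x =>
    open Classical in
    if x 0 ≠ x (Fin.last (k + 1)) then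
      (dividedDiff f k (fun t => x t.succ) - dividedDiff f k (fun t => x t.castSucc)) /
        (x (Fin.last (k + 1)) - x 0)
    else if h : ∃ i, x i ≠ x 0 then
      (dividedDiff f k (fun t => x t.succ) - dividedDiff f k (fun t => x (h.choose.succAbove t))) /
        (x h.choose - x 0)
    else
      iteratedDeriv (k + 1) f (x 0) / ((k + 1).factorial : ℂ)

/-! ### Matrix polynomials -/

variable {n m r : ℕ}

/-- The value `P(z) = ∑ⱼ zʲ Aⱼ`. -/
def value (A : Fin (m + 1) → Matrix (Fin n) (Fin n) ℂ) (z : ℂ) : Matrix (Fin n) (Fin n) ℂ :=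
  ∑ j : Fin (m + 1), z ^ (j : ℕ) • A j

/-- The matrix divided difference `P[x₀, …, xₖ]`, taken entrywise. -/
def matDividedDiff (A : Fin (m + 1) → Matrix (Fin n) (Fin n) ℂ) {k : ℕ} (x : Fin (k + 1) → ℂ) :
    Matrix (Fin n) (Fin n) ℂ :=
  Matrix.of fun a b => dividedDiff (fun z => value A z a b) k x

/-- The polynomial `det (P(λ) + Δ)` in `λ`. -/
def pertDet (A : Fin (m + 1) → Matrix (Fin n) (Fin n) ℂ) (Δ : Matrix (Fin n) (Fin n) ℂ) : ℂ[X] :=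
  ((∑ j : Fin (m + 1), (Polynomial.X : ℂ[X]) ^ (j : ℕ) • (A j).map Polynomial.C) +
    Δ.map Polynomial.C).det

/-- `τᵣ(S)`: the infimum of `‖Δ‖₂` over all `Δ` for which the algebraic multiplicities of the
elements of `S` as eigenvalues of `P + Δ` add up to at least `r` (`∞` if there is no such `Δ`). -/
def tau (A : Fin (m + 1) → Matrix (Fin n) (Fin n) ℂ) (S : Finset ℂ) (r : ℕ) : ℝ≥0∞ :=
  ⨅ Δ ∈ {Δ : Matrix (Fin n) (Fin n) ℂ | r ≤ ∑ z ∈ S, (pertDet A Δ).rootMultiplicity z},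
    ENNReal.ofReal (specNorm Δ)

/-- The parameter space `ℂ^{r(r-1)/2}`: a family `γ_{il}` indexed by the pairs `(i, l)`, `l < i`. -/
abbrev Params (r : ℕ) : Type := {p : Fin r × Fin r // p.2 < p.1} → ℂ

/-- The entry `γ_{il}` for `l < i` (and `0` otherwise). -/
def gam (Γ : Params r) (i l : Fin r) : ℂ :=
  if h : l < i then Γ ⟨(i, l), h⟩ else 0

/-- The upper triangular matrix `C(μ, Γ)` with diagonal `μ` and entry `γ_{il}` at row `l`,
column `i`, for `l < i`. -/
def triC (μ : Fin r → ℂ) (Γ : Params r) : Matrix (Fin r) (Fin r) ℂ :=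
  Matrix.of fun l i => if l = i then μ i else gam Γ i l

/-- `∑ⱼ (C(μ, Γ)ʲ)ᵀ ⊗ Aⱼ`; the index `(i, a)` is entry `a` of block `i`. -/
def kronQ (A : Fin (m + 1) → Matrix (Fin n) (Fin n) ℂ) (μ : Fin r → ℂ) (Γ : Params r) :
    Matrix (Fin r × Fin n) (Fin r × Fin n) ℂ :=
  ∑ j : Fin (m + 1), (triC μ Γ ^ (j : ℕ))ᵀ ⊗ₖ A j

/-- The sum of `γ_{s₁s₀} ⋯ γ_{sₖsₖ₋₁} P[μ_{s₀}, …, μ_{sₖ}]` over all increasing sequences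
`(s₀, …, sₖ)` of indices with `s₀ = l` and `sₖ = i`. -/
def chainSum (A : Fin (m + 1) → Matrix (Fin n) (Fin n) ℂ) (μ : Fin r → ℂ) (Γ : Params r)
    (i l : Fin r) : Matrix (Fin n) (Fin n) ℂ :=
  open Classical in
  ∑ k ∈ Finset.range r,
    ∑ s : Fin (k + 1) → Fin r with StrictMono s ∧ s 0 = l ∧ s (Fin.last k) = i,
      (∏ t : Fin k, gam Γ (s t.succ) (s t.castSucc)) • matDividedDiff A (fun t => μ (s t))

/-- The block lower triangular matrix `Q(μ, Γ, P)` given by divided differences. -/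
def blockQ (A : Fin (m + 1) → Matrix (Fin n) (Fin n) ℂ) (μ : Fin r → ℂ) (Γ : Params r) :
    Matrix (Fin r × Fin n) (Fin r × Fin n) ℂ :=
  Matrix.of fun p q =>
    if q.1 < p.1 then chainSum A μ Γ p.1 q.1 p.2 q.2
    else if p.1 = q.1 then value A (μ p.1) p.2 q.2
    else 0

/-! ### The optimization problem and the two assumptions -/

/-- The objective `σ₋ᵣ(Q(μ, Γ, P))`. -/
def objective (A : Fin (m + 1) → Matrix (Fin n) (Fin n) ℂ) (μ : Fin r → ℂ) (Γ : Params r) : ℝ :=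
  svSmallest r (blockQ A μ Γ)

/-- The inner supremum `sup_Γ σ₋ᵣ(Q(μ, Γ, P))` in `[0, ∞]`. -/
def innerSup (A : Fin (m + 1) → Matrix (Fin n) (Fin n) ℂ) (μ : Fin r → ℂ) : ℝ≥0∞ :=
  ⨆ Γ : Params r, ENNReal.ofReal (objective A μ Γ)

/-- `S^r`. -/
def tuples (S : Finset ℂ) (r : ℕ) : Set (Fin r → ℂ) := {μ | ∀ i, μ i ∈ S}

/-- `μ ∈ S^r` attains the outer infimum. -/
def IsOptimalNodes (A : Fin (m + 1) → Matrix (Fin n) (Fin n) ℂ) (S : Finset ℂ)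
    (μ : Fin r → ℂ) : Prop :=
  μ ∈ tuples S r ∧ ∀ ν ∈ tuples S r, innerSup A μ ≤ innerSup A ν

/-- `Γ` attains the inner supremum at `μ`. -/
def IsOptimalParams (A : Fin (m + 1) → Matrix (Fin n) (Fin n) ℂ) (μ : Fin r → ℂ)
    (Γ : Params r) : Prop :=
  ∀ Γ' : Params r, objective A μ Γ' ≤ objective A μ Γ

/-- Multiplicity assumption: the singular value `σ₋ᵣ(Q(μ, Γ, P))` has multiplicity one. -/
def MultiplicityAssumption (A : Fin (m + 1) → Matrix (Fin n) (Fin n) ℂ) (μ : Fin r → ℂ)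
    (Γ : Params r) : Prop :=
  svMultiplicity (blockQ A μ Γ) (objective A μ Γ) = 1

/-- Linear independence assumption: a consistent pair of unit left and right singular vectors
`vec U`, `vec V` for `σ₋ᵣ(Q(μ, Γ, P))` has `rank V = r`, where `U` and `V` are `n × r`. -/
def LinearIndependenceAssumption (A : Fin (m + 1) → Matrix (Fin n) (Fin n) ℂ) (μ : Fin r → ℂ)
    (Γ : Params r) : Prop :=
  ∃ U V : Matrix (Fin n) (Fin r) ℂ,
    ‖WithLp.toLp 2 U.vec‖ = 1 ∧ ‖WithLp.toLp 2 V.vec‖ = 1 ∧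
    blockQ A μ Γ *ᵥ V.vec = (objective A μ Γ : ℂ) • U.vec ∧
    star U.vec ᵥ* blockQ A μ Γ = (objective A μ Γ : ℂ) • star V.vec ∧
    V.rank = r

end MatPoly

end

/-! ### Extremal properties of singular values -/

/-! Block formula: for a polynomial `p`, each entry of `p(C(μ, Γ))` is a sum over increasing chains
of products of `γ`'s times divided differences of `p`. Both sides obey the same recursion when `p`
is replaced by `X * p`: one side by matrix multiplication, the other by the Leibniz rule
`divDiff_X_mul`. Linearity in `p` then gives `kronQ_eq_blockQ`.

Lower bound for `tau`: in matrix form `Q` is the map `V ↦ ∑ Aⱼ V Cʲ`. If `∏ (X - νᵢ)` divides `det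
(P + Δ)`, then for every `Γ` the map `V ↦ ∑ Aⱼ V Cʲ + Δ V` has a kernel of dimension at least `r`
(`le_finrank_ker_pertMat`). On this kernel `Q` acts as `-Δ`, so min-max gives `σ₋ᵣ(Q) ≤ ‖Δ‖`.

Upper bound: at a maximizer `Γ` with simple `σ = σ₋ᵣ(Q) > 0`, the first-order conditions say that a
certain matrix `B` is upper triangular. With `C = C(μ, Γ)`, the singular vector equations give `B C
- C B = σ (U*U - V*V)`. The left side is strictly upper triangular and the right side Hermitian, so
both vanish and `U*U = V*V` (`gram_eq`). Hence `Δ = -σ U V⁺`, with `V⁺` the left inverse of the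
full-rank `V`, has norm at most `σ` and satisfies `∑ Aⱼ V Cʲ + Δ V = 0`. Then the characteristic
polynomial `∏ (X - μᵢ)` of `C` divides `det (P + Δ)` (`charpoly_dvd_pertDet`). For `σ = 0` the
choice `Δ = 0` needs no Gram identity.

A maximizer is assumed to exist unless `r ≤ n` and all `P[μₖ, μₗ]` are nonsingular. In that case
positive superlevel sets of the objective are bounded (`exists_gam_bound`), and compactness provides
one. -/

theorem OrthonormalBasis.repr_eq_zero_of_mem_span {ι 𝕜 E : Type*} [Fintype ι] [RCLike 𝕜]
    [NormedAddCommGroup E] [InnerProductSpace 𝕜 E] (b : OrthonormalBasis ι 𝕜 E)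
    (p : ι → Prop) {x : E}
    (hx : x ∈ Submodule.span 𝕜 (Set.range fun i : {i // p i} => b i))
    {j : ι} (hj : ¬ p j) : b.repr x j = 0 := by
  induction hx using Submodule.span_induction with
  | mem x hx =>
    obtain ⟨⟨i, hi⟩, rfl⟩ := hx
    have hij : j ≠ i := fun h => hj (h ▸ hi)
    classical simp [hij]
  | zero => simp
  | add x y _ _ hx hy => simp [hx, hy]
  | smul a x _ hx => simp [hx]

theorem OrthonormalBasis.norm_sq_eq_sum_repr {ι 𝕜 E : Type*} [Fintype ι] [RCLike 𝕜]
    [NormedAddCommGroup E] [InnerProductSpace 𝕜 E] (b : OrthonormalBasis ι 𝕜 E) (x : E) :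
    ‖x‖ ^ 2 = ∑ i, ‖b.repr x i‖ ^ 2 := by
  rw [← b.repr.norm_map, EuclideanSpace.norm_sq_eq]

namespace LinearMap

open Module

section SingularValues

variable {𝕜 E F : Type*} [RCLike 𝕜] [NormedAddCommGroup E] [InnerProductSpace 𝕜 E]
  [FiniteDimensional 𝕜 E] [NormedAddCommGroup F] [InnerProductSpace 𝕜 F] [FiniteDimensional 𝕜 F]

/-- The orthonormal basis of right singular vectors, ordered by decreasing singular value. -/
noncomputable def rightSingularBasis (T : E →ₗ[𝕜] F) : OrthonormalBasis (Fin (finrank 𝕜 E)) 𝕜 E :=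
  T.isSymmetric_adjoint_comp_self.eigenvectorBasis rfl

theorem adjoint_apply_rightSingularBasis (T : E →ₗ[𝕜] F) (i : Fin (finrank 𝕜 E)) :
    adjoint T (T (T.rightSingularBasis i)) =
      ((T.singularValues i ^ 2 : ℝ) : 𝕜) • T.rightSingularBasis i := by
  have h := T.isSymmetric_adjoint_comp_self.apply_eigenvectorBasis rfl i
  rw [← T.sq_singularValues_fin rfl i] at h
  exact h

theorem norm_sq_apply_eq_sum (T : E →ₗ[𝕜] F) (x : E) :
    ‖T x‖ ^ 2 = ∑ i : Fin (finrank 𝕜 E), T.singularValues i ^ 2 * ‖T.rightSingularBasis.repr x i‖ ^ 2 := by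
  have h1 : (inner 𝕜 (T x) (T x) : 𝕜) = inner 𝕜 x (adjoint T (T x)) :=
    (adjoint_inner_right T x (T x)).symm
  have h2 : ∀ i, T.rightSingularBasis.repr (adjoint T (T x)) i =
      ((T.singularValues i ^ 2 : ℝ) : 𝕜) * T.rightSingularBasis.repr x i := by
    intro i
    have h := T.isSymmetric_adjoint_comp_self.eigenvectorBasis_apply_self_apply rfl x i
    rw [← T.sq_singularValues_fin rfl i] at h
    exact h
  have h3 : ((‖T x‖ ^ 2 : ℝ) : 𝕜) =
      ((∑ i : Fin (finrank 𝕜 E), T.singularValues i ^ 2 * ‖T.rightSingularBasis.repr x i‖ ^ 2 : ℝ) : 𝕜) := by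
    have h4 := h1
    rw [inner_self_eq_norm_sq_to_K, ← T.rightSingularBasis.repr.inner_map_map, PiLp.inner_apply]
      at h4
    push_cast
    rw [h4]
    refine Finset.sum_congr rfl fun i _ => ?_
    rw [h2, RCLike.inner_apply, mul_assoc, RCLike.mul_conj]
    push_cast
    ring
  exact_mod_cast h3

/-- The span of the first `k` right singular vectors. -/
noncomputable def topSpan (T : E →ₗ[𝕜] F) (k : ℕ) : Submodule 𝕜 E :=
  Submodule.span 𝕜 (Set.range fun i : {i : Fin (finrank 𝕜 E) // (i : ℕ) < k} =>
    T.rightSingularBasis i)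

/-- The span of all right singular vectors but the first `k`. -/
noncomputable def bottomSpan (T : E →ₗ[𝕜] F) (k : ℕ) : Submodule 𝕜 E :=
  Submodule.span 𝕜 (Set.range fun i : {i : Fin (finrank 𝕜 E) // k ≤ (i : ℕ)} =>
    T.rightSingularBasis i)

theorem finrank_topSpan (T : E →ₗ[𝕜] F) {k : ℕ} (hk : k ≤ finrank 𝕜 E) :
    finrank 𝕜 (T.topSpan k) = k := by
  have hli : LinearIndependent 𝕜 fun i : {i : Fin (finrank 𝕜 E) // (i : ℕ) < k} =>
      T.rightSingularBasis i :=
    T.rightSingularBasis.orthonormal.linearIndependent.comp _ Subtype.val_injective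
  rw [topSpan, finrank_span_eq_card hli, Fintype.card_subtype]
  simpa [hk] using Fin.card_filter_val_lt (n := finrank 𝕜 E) (m := k)

theorem finrank_bottomSpan (T : E →ₗ[𝕜] F) (k : ℕ) :
    finrank 𝕜 (T.bottomSpan k) = finrank 𝕜 E - k := by
  have hli : LinearIndependent 𝕜 fun i : {i : Fin (finrank 𝕜 E) // k ≤ (i : ℕ)} =>
      T.rightSingularBasis i :=
    T.rightSingularBasis.orthonormal.linearIndependent.comp _ Subtype.val_injective
  rw [bottomSpan, finrank_span_eq_card hli, Fintype.card_subtype]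
  have h := Finset.card_filter_add_card_filter_not (s := (Finset.univ : Finset (Fin (finrank 𝕜 E))))
    fun i => (i : ℕ) < k
  have h' := Fin.card_filter_val_lt (n := finrank 𝕜 E) (m := k)
  simp only [not_lt, Finset.card_univ, Fintype.card_fin] at h
  omega

theorem singularValues_mul_norm_le_of_mem_topSpan (T : E →ₗ[𝕜] F) {k j : ℕ} (hkj : k ≤ j + 1)
    {x : E} (hx : x ∈ T.topSpan k) : T.singularValues j * ‖x‖ ≤ ‖T x‖ := by
  have h0 := T.singularValues_nonneg j
  refine le_of_sq_le_sq ?_ (norm_nonneg _)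
  rw [mul_pow, norm_sq_apply_eq_sum, T.rightSingularBasis.norm_sq_eq_sum_repr, Finset.mul_sum]
  refine Finset.sum_le_sum fun i _ => ?_
  by_cases hi : (i : ℕ) < k
  · have := T.singularValues_antitone (show (i : ℕ) ≤ j by omega)
    gcongr
  · rw [T.rightSingularBasis.repr_eq_zero_of_mem_span (fun i => (i : ℕ) < k) hx hi]
    simp

theorem norm_le_of_mem_bottomSpan (T : E →ₗ[𝕜] F) {k : ℕ} {x : E} (hx : x ∈ T.bottomSpan k) :
    ‖T x‖ ≤ T.singularValues k * ‖x‖ := by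
  have h0 := T.singularValues_nonneg k
  refine le_of_sq_le_sq ?_ (by positivity)
  rw [mul_pow, norm_sq_apply_eq_sum, T.rightSingularBasis.norm_sq_eq_sum_repr, Finset.mul_sum]
  refine Finset.sum_le_sum fun i _ => ?_
  by_cases hi : k ≤ (i : ℕ)
  · have := T.singularValues_antitone hi
    have := T.singularValues_nonneg i
    gcongr
  · rw [T.rightSingularBasis.repr_eq_zero_of_mem_span (fun i => k ≤ (i : ℕ)) hx hi]
    simp

/-- The dimension count behind both extremal principles: a test space must meet a span of singular
vectors nontrivially. -/
theorem exists_ne_zero_mem_inf {W W' : Submodule 𝕜 E}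
    (h : finrank 𝕜 E < finrank 𝕜 W + finrank 𝕜 W') : ∃ x ∈ W, x ∈ W' ∧ x ≠ 0 := by
  have h1 := Submodule.finrank_sup_add_finrank_inf_eq W W'
  have h2 := Submodule.finrank_le (W ⊔ W')
  have h3 : W ⊓ W' ≠ ⊥ := by
    intro h4
    rw [h4, finrank_bot] at h1
    omega
  obtain ⟨x, hx, hx0⟩ := Submodule.exists_mem_ne_zero_of_ne_bot h3
  exact ⟨x, hx.1, hx.2, hx0⟩

/-- Max-min principle: a lower bound on a subspace of dimension `> k` bounds `σₖ` from below. -/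
theorem lt_singularValues (T : E →ₗ[𝕜] F) {k : ℕ} {c : ℝ} (W : Submodule 𝕜 E)
    (hW : k < finrank 𝕜 W) (h : ∀ x ∈ W, x ≠ 0 → c * ‖x‖ < ‖T x‖) : c < T.singularValues k := by
  have hE := Submodule.finrank_le W
  obtain ⟨x, hxW, hxB, hx0⟩ := exists_ne_zero_mem_inf (W := W) (W' := T.bottomSpan k)
    (by rw [finrank_bottomSpan]; omega)
  exact lt_of_mul_lt_mul_right ((h x hxW hx0).trans_le (T.norm_le_of_mem_bottomSpan hxB))
    (norm_nonneg x)

/-- Min-max principle: an upper bound on a subspace of codimension `≤ k` bounds `σₖ` from above. -/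
theorem singularValues_le (T : E →ₗ[𝕜] F) {k : ℕ} {c : ℝ} (W : Submodule 𝕜 E)
    (hk : k < finrank 𝕜 E) (hW : finrank 𝕜 E ≤ k + finrank 𝕜 W)
    (h : ∀ x ∈ W, ‖T x‖ ≤ c * ‖x‖) : T.singularValues k ≤ c := by
  obtain ⟨x, hxW, hxB, hx0⟩ := exists_ne_zero_mem_inf (W := W) (W' := T.topSpan (k + 1))
    (by rw [finrank_topSpan _ (by omega)]; omega)
  exact le_of_mul_le_mul_right
    ((T.singularValues_mul_norm_le_of_mem_topSpan le_rfl hxB).trans (h x hxW))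
    (norm_pos_iff.mpr hx0)

/-- Weyl's inequality, obtained by testing `T` on the bottom singular space of `S`. It yields
continuity of the objective. -/
theorem singularValues_le_add (T S : E →ₗ[𝕜] F) {c : ℝ} (k : ℕ) (hc : 0 ≤ c)
    (h : ∀ x, ‖T x - S x‖ ≤ c * ‖x‖) : T.singularValues k ≤ S.singularValues k + c := by
  by_cases hk : k < finrank 𝕜 E
  · refine T.singularValues_le (S.bottomSpan k) hk (by rw [finrank_bottomSpan]; omega) fun x hx => ?_
    have h1 := S.norm_le_of_mem_bottomSpan hx
    have h2 := norm_sub_norm_le (T x) (S x)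
    have h3 := h x
    linarith
  · rw [T.singularValues_of_finrank_le (not_lt.mp hk)]
    exact add_nonneg (S.singularValues_nonneg k) hc

/-- Eigenvectors of the self-adjoint `T*T` for distinct eigenvalues are orthogonal. Here `v` is any
eigenvector for `σₖ²`, not necessarily a member of the chosen basis. -/
theorem inner_eq_zero_of_mem_topSpan (T : E →ₗ[𝕜] F) {k : ℕ} {v y : E}
    (hTv : adjoint T (T v) = ((T.singularValues k ^ 2 : ℝ) : 𝕜) • v)
    (hgap : ∀ j < k, T.singularValues k < T.singularValues j) (hy : y ∈ T.topSpan k) :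
    inner 𝕜 y v = 0 := by
  induction hy using Submodule.span_induction with
  | mem y hy =>
    obtain ⟨⟨i, hi⟩, rfl⟩ := hy
    have h1 : inner 𝕜 (adjoint T (T (T.rightSingularBasis i))) v =
        inner 𝕜 (T.rightSingularBasis i) (adjoint T (T v)) := by
      rw [adjoint_inner_left, adjoint_inner_right]
    rw [adjoint_apply_rightSingularBasis, hTv, inner_smul_left, inner_smul_right,
      RCLike.conj_ofReal] at h1
    have h2 := hgap i hi
    have h3 : T.singularValues i ^ 2 - T.singularValues k ^ 2 ≠ 0 := by
      have := T.singularValues_nonneg k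
      nlinarith
    have h4 : ((T.singularValues i ^ 2 - T.singularValues k ^ 2 : ℝ) : 𝕜) *
        inner 𝕜 (T.rightSingularBasis i) v = 0 := by
      push_cast at h1 ⊢
      rw [sub_mul, h1, sub_self]
    exact (mul_eq_zero.mp h4).resolve_left (by exact_mod_cast h3)
  | zero => simp
  | add x y _ _ hx hy => rw [inner_add_left, hx, hy, add_zero]
  | smul a x _ hx => rw [inner_smul_left, hx, mul_zero]

theorem exists_gap_of_topSpan (T : E →ₗ[𝕜] F) {k : ℕ}
    (hgap : ∀ j < k, T.singularValues k < T.singularValues j) :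
    ∃ g > 0, ∀ y ∈ T.topSpan k, (T.singularValues k ^ 2 + g) * ‖y‖ ^ 2 ≤ ‖T y‖ ^ 2 := by
  have h0 := T.singularValues_nonneg k
  rcases k with _ | j
  -- For `k = 0` the span is trivial, so any positive gap works.
  · refine ⟨1, one_pos, fun y hy => ?_⟩
    have : IsEmpty {i : Fin (finrank 𝕜 E) // (i : ℕ) < 0} := ⟨fun i => absurd i.2 (by omega)⟩
    rw [topSpan, Set.range_eq_empty, Submodule.span_empty, Submodule.mem_bot] at hy
    simp [hy]
  · have h1 := hgap j (by omega)
    refine ⟨T.singularValues j ^ 2 - T.singularValues (j + 1) ^ 2, by nlinarith, fun y hy => ?_⟩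
    have h2 := T.singularValues_mul_norm_le_of_mem_topSpan le_rfl hy
    have h3 : (T.singularValues j * ‖y‖) ^ 2 ≤ ‖T y‖ ^ 2 :=
      pow_le_pow_left₀ (mul_nonneg (T.singularValues_nonneg j) (norm_nonneg y)) h2 2
    linarith [mul_pow (T.singularValues j) ‖y‖ 2]

/-- Complete the square after multiplying by `2g`. In the application `Y = ‖y‖`, `A = |a|` and `V =
‖v‖` for a test vector `y + a v`; `g` is the spectral gap and `h` the derivative along `v`. For
small `t` the gap absorbs the cross terms. -/
theorem quadratic_form_pos {g h t K V A Y : ℝ} (hg : 0 < g) (ht : 0 < t)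
    (h1 : 8 * t * K < g) (h2 : 8 * t * K ^ 2 * V ^ 2 < g * h)
    (hAY : A ≠ 0 ∨ Y ≠ 0) :
    0 < g * Y ^ 2 + 2 * t * (A ^ 2 * (h / 2) - K * (2 * A * V * Y + Y ^ 2)) := by
  have e : 2 * g * (g * Y ^ 2 + 2 * t * (A ^ 2 * (h / 2) - K * (2 * A * V * Y + Y ^ 2))) =
      (g * Y - 4 * t * K * V * A) ^ 2 + (g - 4 * t * K) * g * Y ^ 2
        + 2 * t * (g * h - 8 * t * K ^ 2 * V ^ 2) * A ^ 2 := by ring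
  have h3 : 0 < g - 4 * t * K := by nlinarith
  have h4 : 0 < g * h - 8 * t * K ^ 2 * V ^ 2 := by linarith
  have h5 : 0 < 2 * g * (g * Y ^ 2 + 2 * t * (A ^ 2 * (h / 2) - K * (2 * A * V * Y + Y ^ 2))) := by
    rw [e]
    rcases hAY with h | h <;> positivity
  exact pos_of_mul_pos_right h5 (by positivity)

/-- First-order perturbation: if the derivative of `‖(T + t • D t) v‖` at `t = 0` is positive for a
singular vector `v` of `σₖ`, and `σₖ` is separated from the larger singular values, then `σₖ`
grows for some `t`. -/
theorem exists_singularValues_lt (T : E →L[𝕜] F) (D : ℝ → E →L[𝕜] F) (hD : Continuous D) {k : ℕ}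
    (hk : k < finrank 𝕜 E) {v : E} (hv : v ≠ 0)
    (hTv : adjoint (T : E →ₗ[𝕜] F) (T v) =
      (((T : E →ₗ[𝕜] F).singularValues k ^ 2 : ℝ) : 𝕜) • v)
    (hgap : ∀ j < k, (T : E →ₗ[𝕜] F).singularValues k < (T : E →ₗ[𝕜] F).singularValues j)
    (hpos : 0 < RCLike.re (inner 𝕜 (T v) (D 0 v))) :
    ∃ t : ℝ, (T : E →ₗ[𝕜] F).singularValues k <
      ((T + (t : 𝕜) • D t : E →L[𝕜] F) : E →ₗ[𝕜] F).singularValues k := by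
  set T' : E →ₗ[𝕜] F := (T : E →ₗ[𝕜] F) with hT'
  set σ := T'.singularValues k with hσ
  obtain ⟨g, hg, hgy⟩ := T'.exists_gap_of_topSpan hgap
  set h := RCLike.re (inner 𝕜 (T v) (D 0 v))
  set K := ‖T‖ * (‖D 0‖ + 1) with hK
  have hK0 : 0 ≤ K := by positivity
  have ev1 : ∀ᶠ t in nhdsWithin (0 : ℝ) (Set.Ioi 0), ‖D t‖ < ‖D 0‖ + 1 :=
    nhdsWithin_le_nhds ((hD.norm.tendsto 0).eventually_lt_const (lt_add_one _))
  have ev2 : ∀ᶠ t in nhdsWithin (0 : ℝ) (Set.Ioi 0), h / 2 < RCLike.re (inner 𝕜 (T v) (D t v)) := by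
    have hc : Continuous fun t => RCLike.re (inner 𝕜 (T v) (D t v)) := by fun_prop
    exact nhdsWithin_le_nhds ((hc.tendsto 0).eventually_const_lt (half_lt_self hpos))
  have ev3 : ∀ᶠ t in nhdsWithin (0 : ℝ) (Set.Ioi 0), 8 * t * K < g := by
    have hc : Continuous fun t : ℝ => 8 * t * K := by fun_prop
    exact nhdsWithin_le_nhds ((hc.tendsto 0).eventually_lt_const (by simpa using hg))
  have ev4 : ∀ᶠ t in nhdsWithin (0 : ℝ) (Set.Ioi 0), 8 * t * K ^ 2 * ‖v‖ ^ 2 < g * h := by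
    have hc : Continuous fun t : ℝ => 8 * t * K ^ 2 * ‖v‖ ^ 2 := by fun_prop
    exact nhdsWithin_le_nhds
      ((hc.tendsto 0).eventually_lt_const (by simpa using mul_pos hg hpos))
  obtain ⟨t, ht1, ht2, ht3, ht4, ht0⟩ :=
    (ev1.and (ev2.and (ev3.and (ev4.and self_mem_nhdsWithin)))).exists
  have ht0 : 0 < t := ht0
  -- The test space has dimension `k + 1`. On the top span the gap gives room, and on `v` the
  -- positive derivative does.
  refine ⟨t, lt_singularValues _ (T'.topSpan k ⊔ Submodule.span 𝕜 {v}) ?_ ?_⟩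
  · have hlt : T'.topSpan k < T'.topSpan k ⊔ Submodule.span 𝕜 {v} := by
      refine lt_of_le_of_ne le_sup_left fun he => hv ?_
      have hvm : v ∈ T'.topSpan k := by
        rw [he]
        exact Submodule.mem_sup_right (Submodule.mem_span_singleton_self v)
      exact inner_self_eq_zero.mp (T'.inner_eq_zero_of_mem_topSpan hTv hgap hvm)
    have := Submodule.finrank_lt_finrank_of_lt hlt
    rwa [finrank_topSpan _ hk.le] at this
  intro x hx hx0
  obtain ⟨y, hy, z, hz, rfl⟩ := Submodule.mem_sup.mp hx
  obtain ⟨a, rfl⟩ := Submodule.mem_span_singleton.mp hz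
  have hyv := T'.inner_eq_zero_of_mem_topSpan hTv hgap hy
  -- Orthogonality of `y` and `v` passes to their images because `v` is an eigenvector of `T*T`, so
  -- neither norm below has a cross term.
  have hTyv : inner 𝕜 (T y) (T v) = 0 := by
    have : inner 𝕜 (T' y) (T' v) = inner 𝕜 y (adjoint T' (T' v)) := (adjoint_inner_right _ _ _).symm
    rw [show T' v = T v from rfl, hTv, inner_smul_right, hyv, mul_zero] at this
    exact this
  have hTvn : ‖T v‖ ^ 2 = σ ^ 2 * ‖v‖ ^ 2 := by
    have h1 : inner 𝕜 (T' v) (T' v) = inner 𝕜 v (adjoint T' (T' v)) :=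
      (adjoint_inner_right _ _ _).symm
    rw [show T' v = T v from rfl, hTv, inner_smul_right, inner_self_eq_norm_sq_to_K,
      inner_self_eq_norm_sq_to_K] at h1
    exact_mod_cast h1
  have hxn : ‖y + a • v‖ ^ 2 = ‖y‖ ^ 2 + ‖a‖ ^ 2 * ‖v‖ ^ 2 := by
    rw [norm_add_sq (𝕜 := 𝕜), inner_smul_right, hyv, norm_smul]
    simp [mul_pow]
  have hTxn : ‖T (y + a • v)‖ ^ 2 = ‖T y‖ ^ 2 + ‖a‖ ^ 2 * (σ ^ 2 * ‖v‖ ^ 2) := by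
    rw [map_add, map_smul, norm_add_sq (𝕜 := 𝕜), inner_smul_right, hTyv, norm_smul, ← hTvn]
    simp [mul_pow]
  have bound : ∀ p q : E, |RCLike.re (inner 𝕜 (T p) (D t q))| ≤ K * (‖p‖ * ‖q‖) := by
    intro p q
    calc |RCLike.re (inner 𝕜 (T p) (D t q))| ≤ ‖inner 𝕜 (T p) (D t q)‖ := RCLike.abs_re_le_norm _
      _ ≤ ‖T p‖ * ‖D t q‖ := norm_inner_le_norm _ _
      _ ≤ (‖T‖ * ‖p‖) * ((‖D 0‖ + 1) * ‖q‖) := by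
        gcongr
        · exact T.le_opNorm p
        · exact (D t).le_of_opNorm_le ht1.le q
      _ = K * (‖p‖ * ‖q‖) := by rw [hK]; ring
  have hcross : ‖a‖ ^ 2 * (h / 2) - K * (2 * ‖a‖ * ‖v‖ * ‖y‖ + ‖y‖ ^ 2) ≤
      RCLike.re (inner 𝕜 (T (y + a • v)) (D t (y + a • v))) := by
    have e : RCLike.re (inner 𝕜 (T (y + a • v)) (D t (y + a • v))) =
        RCLike.re (inner 𝕜 (T y) (D t y)) + RCLike.re (inner 𝕜 (T y) (D t (a • v))) +
        RCLike.re (inner 𝕜 (T (a • v)) (D t y)) +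
        ‖a‖ ^ 2 * RCLike.re (inner 𝕜 (T v) (D t v)) := by
      have e1 : RCLike.re (inner 𝕜 (T (a • v)) (D t (a • v))) =
          ‖a‖ ^ 2 * RCLike.re (inner 𝕜 (T v) (D t v)) := by
        rw [map_smul, map_smul, inner_smul_left, inner_smul_right, ← mul_assoc, RCLike.conj_mul,
          ← RCLike.ofReal_pow, RCLike.re_ofReal_mul]
      rw [← e1, map_add, map_add, inner_add_left, inner_add_right, inner_add_right]
      simp only [map_add]
      ring
    have b1 := (abs_le.mp (bound y y)).1
    have b2 := (abs_le.mp (bound y (a • v))).1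
    have b3 := (abs_le.mp (bound (a • v) y)).1
    rw [norm_smul] at b2 b3
    have b4 : ‖a‖ ^ 2 * (h / 2) ≤ ‖a‖ ^ 2 * RCLike.re (inner 𝕜 (T v) (D t v)) := by gcongr
    rw [e]
    linarith
  have hAY : ‖a‖ ≠ 0 ∨ ‖y‖ ≠ 0 := by
    by_contra! hc
    exact hx0 (by rw [norm_eq_zero.mp hc.1, norm_eq_zero.mp hc.2]; simp)
  have hq := quadratic_form_pos hg ht0 ht3 ht4 hAY
  refine lt_of_pow_lt_pow_left₀ 2 (norm_nonneg _) ?_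
  have hexp : ‖(T + (t : 𝕜) • D t) (y + a • v)‖ ^ 2 = ‖T (y + a • v)‖ ^ 2 +
      2 * t * RCLike.re (inner 𝕜 (T (y + a • v)) (D t (y + a • v))) +
      t ^ 2 * ‖D t (y + a • v)‖ ^ 2 := by
    rw [_root_.add_apply, _root_.smul_apply, norm_add_sq (𝕜 := 𝕜),
      inner_smul_right, RCLike.re_ofReal_mul, norm_smul, RCLike.norm_ofReal, mul_pow, sq_abs]
    ring
  have hgy' := hgy y hy
  have hmul := mul_le_mul_of_nonneg_left hcross (show 0 ≤ 2 * t by linarith)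
  have hsq : 0 ≤ t ^ 2 * ‖D t (y + a • v)‖ ^ 2 := by positivity
  change (σ * ‖y + a • v‖) ^ 2 < ‖(T + (t : 𝕜) • D t) (y + a • v)‖ ^ 2
  rw [hexp, hTxn, mul_pow, hxn]
  change (σ ^ 2 + g) * ‖y‖ ^ 2 ≤ ‖T y‖ ^ 2 at hgy'
  linarith

end SingularValues

end LinearMap

/-! ### Divided differences of polynomials -/

namespace Polynomial

/-- `∏ᵢ (X - xᵢ)`. -/
noncomputable def nodal {ι : Type*} [Fintype ι] (x : ι → ℂ) : ℂ[X] := ∏ t, (X - C (x t))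

theorem nodal_monic {ι : Type*} [Fintype ι] (x : ι → ℂ) : (nodal x).Monic :=
  monic_prod_of_monic _ _ fun _ _ => monic_X_sub_C _

theorem natDegree_nodal {ι : Type*} [Fintype ι] (x : ι → ℂ) :
    (nodal x).natDegree = Fintype.card ι := by
  rw [nodal, natDegree_prod_of_monic _ _ fun _ _ => monic_X_sub_C _]
  simp

theorem degree_nodal {ι : Type*} [Fintype ι] (x : ι → ℂ) :
    (nodal x).degree = Fintype.card ι := by
  rw [degree_eq_natDegree (nodal_monic x).ne_zero, natDegree_nodal]

/-- The divided difference of a polynomial: the leading coefficient of the interpolant. -/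
noncomputable def divDiff (p : ℂ[X]) {k : ℕ} (x : Fin (k + 1) → ℂ) : ℂ :=
  (p %ₘ nodal x).coeff k

theorem modByMonic_eq_of_mul {q w u : ℂ[X]} (hw : w.Monic) (hu : u.Monic) (p : ℂ[X])
    (h : q = w * u) : (p %ₘ q) %ₘ w = p %ₘ w := by
  have hq : q.Monic := h ▸ hw.mul hu
  conv_rhs => rw [← modByMonic_add_div p q]
  rw [add_modByMonic, h, mul_assoc, (modByMonic_eq_zero_iff_dvd hw).mpr (dvd_mul_right _ _), add_zero]

/-- Adding a node `a` to the nodes `y` changes the interpolant by a multiple of `∏ (X - yᵢ)`. -/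
theorem modByMonic_nodal_eq (p : ℂ[X]) {k : ℕ} {y : Fin k → ℂ} {x : Fin (k + 1) → ℂ} {a : ℂ}
    (h : nodal x = nodal y * (X - C a)) :
    p %ₘ nodal x = C (divDiff p x) * nodal y + p %ₘ nodal y := by
  have hd : (p %ₘ nodal x).degree < (k + 1 : ℕ) := by
    have := degree_modByMonic_lt p (nodal_monic x)
    rwa [degree_nodal, Fintype.card_fin] at this
  have hR : (p %ₘ nodal x - C (divDiff p x) * nodal y).degree < (k : ℕ) := by
    rw [degree_lt_iff_coeff_zero]
    intro m hm
    rw [coeff_sub, coeff_C_mul]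
    rcases hm.eq_or_lt with rfl | hm
    · have h1 : (nodal y).coeff k = 1 := by
        have := (nodal_monic y).coeff_natDegree
        rwa [natDegree_nodal, Fintype.card_fin] at this
      rw [h1, mul_one, divDiff, sub_self]
    · rw [coeff_eq_zero_of_degree_lt (hd.trans_le (by exact_mod_cast hm)),
        coeff_eq_zero_of_natDegree_lt (by rw [natDegree_nodal]; simpa using hm)]
      simp
  have h2 : (p %ₘ nodal x - C (divDiff p x) * nodal y) %ₘ nodal y =
      p %ₘ nodal x - C (divDiff p x) * nodal y :=
    (modByMonic_eq_self_iff (nodal_monic y)).mpr (by rwa [degree_nodal, Fintype.card_fin])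
  have h3 := modByMonic_eq_of_mul (nodal_monic y) (monic_X_sub_C a) p h
  rw [sub_modByMonic, h3, (modByMonic_eq_zero_iff_dvd (nodal_monic y)).mpr (dvd_mul_left _ _),
    sub_zero] at h2
  rw [h2]
  ring

/-- Both smaller interpolants arise from the one on all nodes by subtracting the same multiple of
their nodal polynomials, which differ by `(a - b)` times the common factor. Describing node families
by nodal polynomials makes their order irrelevant. -/
theorem divDiff_sub_eq (p : ℂ[X]) {k : ℕ} {w : Fin k → ℂ} {y z : Fin (k + 1) → ℂ}
    {x : Fin (k + 2) → ℂ} {a b : ℂ} (hy : nodal y = nodal w * (X - C a))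
    (hz : nodal z = nodal w * (X - C b)) (hx : nodal x = nodal w * (X - C a) * (X - C b)) :
    divDiff p y - divDiff p z = (a - b) * divDiff p x := by
  have h1 := modByMonic_nodal_eq p (y := y) (x := x) (a := b) (by rw [hx, hy])
  have h2 := modByMonic_nodal_eq p (y := z) (x := x) (a := a) (by rw [hx, hz]; ring)
  have h3 : p %ₘ nodal y - p %ₘ nodal z = C ((a - b) * divDiff p x) * nodal w := by
    have e : p %ₘ nodal y - p %ₘ nodal z = C (divDiff p x) * (nodal z - nodal y) := by
      linear_combination h2 - h1
    rw [e, hy, hz]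
    simp only [C_mul, C_sub]
    ring
  have h4 := congrArg (fun q => coeff q k) h3
  have h5 : (nodal w).coeff k = 1 := by
    have := (nodal_monic w).coeff_natDegree
    rwa [natDegree_nodal, Fintype.card_fin] at this
  simp only [coeff_sub, coeff_C_mul, h5, mul_one] at h4
  exact h4

theorem nodal_succ {k : ℕ} (x : Fin (k + 1) → ℂ) :
    nodal x = nodal (fun t : Fin k => x t.succ) * (X - C (x 0)) := by
  rw [nodal, nodal, Fin.prod_univ_succ, mul_comm]

theorem nodal_castSucc {k : ℕ} (x : Fin (k + 1) → ℂ) :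
    nodal x = nodal (fun t : Fin k => x t.castSucc) * (X - C (x (Fin.last k))) := by
  rw [nodal, nodal, Fin.prod_univ_castSucc]

theorem nodal_succAbove {k : ℕ} (x : Fin (k + 1) → ℂ) (i : Fin (k + 1)) :
    nodal x = nodal (fun t : Fin k => x (i.succAbove t)) * (X - C (x i)) := by
  rw [nodal, nodal, Fin.prod_univ_succAbove _ i, mul_comm]

theorem divDiff_zero (p : ℂ[X]) (x : Fin 1 → ℂ) : divDiff p x = p.eval (x 0) := by
  rw [divDiff, nodal, Fin.prod_univ_one, modByMonic_X_sub_C_eq_C_eval, coeff_C_zero]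

theorem divDiff_add (p q : ℂ[X]) {k : ℕ} (x : Fin (k + 1) → ℂ) :
    divDiff (p + q) x = divDiff p x + divDiff q x := by
  rw [divDiff, add_modByMonic, coeff_add, divDiff, divDiff]

theorem divDiff_C_mul (a : ℂ) (p : ℂ[X]) {k : ℕ} (x : Fin (k + 1) → ℂ) :
    divDiff (C a * p) x = a * divDiff p x := by
  rw [divDiff, ← smul_eq_C_mul, smul_modByMonic, coeff_smul, divDiff, smul_eq_mul]

theorem divDiff_finset_sum {ι : Type*} (s : Finset ι) (p : ι → ℂ[X]) {k : ℕ}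
    (x : Fin (k + 1) → ℂ) : divDiff (∑ i ∈ s, p i) x = ∑ i ∈ s, divDiff (p i) x := by
  classical
  induction s using Finset.induction_on with
  | empty => simp [divDiff]
  | insert a s ha ih => rw [Finset.sum_insert ha, Finset.sum_insert ha, divDiff_add, ih]

/-- The Leibniz rule for divided differences of `X * p`. -/
theorem divDiff_X_mul (p : ℂ[X]) {k : ℕ} (x : Fin (k + 2) → ℂ) :
    divDiff (X * p) x = x 0 * divDiff p x + divDiff p (fun t : Fin (k + 1) => x t.succ) := by
  set y : Fin (k + 1) → ℂ := fun t => x t.succ with hy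
  have hx := nodal_succ x
  have h1 := modByMonic_nodal_eq p hx
  have hdy : (p %ₘ nodal y).degree < (k + 1 : ℕ) := by
    have := degree_modByMonic_lt p (nodal_monic y)
    rwa [degree_nodal, Fintype.card_fin] at this
  have hdx : (p %ₘ nodal x).degree < (k + 2 : ℕ) := by
    have := degree_modByMonic_lt p (nodal_monic x)
    rwa [degree_nodal, Fintype.card_fin] at this
  -- Write `X p = x₀ p + (X - x₀) p` and reduce the second `p` only modulo the nodal polynomial
  -- without `x₀`; the factor `X - x₀` restores the missing node, and the degree stays low enough
  -- for a remainder.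
  have h2 : X * p = (C (x 0) * (p %ₘ nodal x) + (X - C (x 0)) * (p %ₘ nodal y)) +
      nodal x * (C (divDiff p x) + X * (p /ₘ nodal x)) := by
    conv_lhs => rw [← modByMonic_add_div p (nodal x)]
    linear_combination (C (divDiff p x)) * (-hx) + (X - C (x 0)) * h1
  have h3 : (X * p) %ₘ nodal x =
      C (x 0) * (p %ₘ nodal x) + (X - C (x 0)) * (p %ₘ nodal y) := by
    rw [h2, add_modByMonic, (modByMonic_eq_zero_iff_dvd (nodal_monic x)).mpr (dvd_mul_right _ _),
      add_zero, modByMonic_eq_self_iff (nodal_monic x), degree_nodal, Fintype.card_fin,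
      degree_lt_iff_coeff_zero]
    intro m hm
    obtain ⟨m, rfl⟩ : ∃ j, m = j + 1 := ⟨m - 1, by omega⟩
    rw [degree_lt_iff_coeff_zero] at hdx hdy
    simp [sub_mul, coeff_X_mul, hdx _ hm, hdy _ (show k + 1 ≤ m by omega),
      hdy _ (show k + 1 ≤ m + 1 by omega)]
  rw [divDiff, h3]
  rw [degree_lt_iff_coeff_zero] at hdy
  simp [sub_mul, coeff_X_mul, divDiff, hdy (k + 1) le_rfl]

theorem divDiff_one_succ {k : ℕ} (x : Fin (k + 2) → ℂ) : divDiff 1 x = 0 := by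
  rw [divDiff, (modByMonic_eq_self_iff (nodal_monic x)).mpr]
  · simp [coeff_one]
  · rw [degree_nodal, degree_one]
    exact_mod_cast Fintype.card_pos

theorem iteratedDeriv_eval (p : ℂ[X]) (k : ℕ) :
    iteratedDeriv k (fun z => p.eval z) = fun z => (derivative^[k] p).eval z := by
  induction k generalizing p with
  | zero => simp
  | succ k ih =>
    have h : _root_.deriv (fun z => p.eval z) = fun z => p.derivative.eval z := by
      funext z
      exact p.deriv
    rw [iteratedDeriv_succ', h, ih]
    rfl

/-- At a single repeated node the divided difference is a Taylor coefficient. -/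
theorem divDiff_const (p : ℂ[X]) (k : ℕ) (a : ℂ) :
    divDiff p (fun _ : Fin (k + 1) => a) =
      iteratedDeriv k (fun z => p.eval z) a / (k.factorial : ℂ) := by
  have hn : nodal (fun _ : Fin (k + 1) => a) = (X - C a) ^ (k + 1) := by simp [nodal]
  have h1 : iteratedDeriv k (fun z => p.eval z) a = k.factorial * (taylor a p).coeff k := by
    rw [iteratedDeriv_eval, taylor_coeff, ← factorial_smul_hasseDeriv]
    simp
  have hd : (p %ₘ (X - C a) ^ (k + 1)).natDegree ≤ k := by
    rw [← hn]
    have := degree_modByMonic_lt p (nodal_monic (fun _ : Fin (k + 1) => a))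
    rw [degree_nodal, Fintype.card_fin] at this
    exact natDegree_le_of_degree_le (Order.lt_succ_iff.mp this)
  rw [h1, mul_div_cancel_left₀ _ (by exact_mod_cast k.factorial_ne_zero), divDiff, hn]
  conv_rhs => rw [← modByMonic_add_div p ((X - C a) ^ (k + 1))]
  -- The Taylor shift turns `(X - a) ^ (k + 1)` into `X ^ (k + 1)`, whose multiples have no
  -- coefficient of degree `k`.
  rw [map_add, taylor_mul, taylor_pow]
  have hX : taylor a (X - C a) = X := by simp
  rw [hX, coeff_add, coeff_X_pow_mul', if_neg (by omega), add_zero]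
  rcases hd.eq_or_lt with h | h
  · have := coeff_taylor_natDegree a (p %ₘ (X - C a) ^ (k + 1))
    rw [h] at this
    rw [this, leadingCoeff, h]
  · rw [coeff_eq_zero_of_natDegree_lt h, coeff_eq_zero_of_natDegree_lt (by rwa [natDegree_taylor])]

end Polynomial

noncomputable section

namespace MatPoly

open Polynomial

/-- Both branches with distinct nodes are instances of `divDiff_sub_eq`, whichever node was chosen;
the last branch is `divDiff_const`. -/
theorem dividedDiff_eval (p : ℂ[X]) (k : ℕ) (x : Fin (k + 1) → ℂ) :
    dividedDiff (fun z => p.eval z) k x = p.divDiff x := by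
  induction k with
  | zero => rw [dividedDiff, divDiff_zero]
  | succ k ih =>
    rw [dividedDiff]
    split_ifs with h1 h2
    · rw [ih, ih, div_eq_iff (sub_ne_zero.mpr (Ne.symm h1)), mul_comm]
      set w : Fin k → ℂ := fun t => x t.succ.castSucc
      refine divDiff_sub_eq p (w := w) ?_ ?_ ?_
      · rw [nodal_castSucc]; rfl
      · rw [nodal_succ]; rfl
      · rw [nodal_succ, nodal_castSucc]
        rfl
    · rw [ih, ih, div_eq_iff (sub_ne_zero.mpr h2.choose_spec), mul_comm]
      obtain ⟨j, hj⟩ : ∃ j : Fin (k + 1), h2.choose = j.succ :=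
        ⟨_, (Fin.succ_pred _ fun h => h2.choose_spec (by rw [h])).symm⟩
      rw [hj]
      set w : Fin k → ℂ := fun t => x (j.succAbove t).succ
      refine divDiff_sub_eq p (w := w) ?_ ?_ ?_
      · rw [nodal_succAbove _ j]
      · obtain _ | k := k
        · rw [nodal_succ]
          congr 2
          exact funext fun t => t.elim0
        · rw [nodal_succ]
          congr 2
          simp [w, Fin.succ_succAbove_succ]
      · rw [nodal_succ, nodal_succAbove _ j]
    · push Not at h2
      rw [← divDiff_const]
      congr 1
      exact funext fun t => (h2 t).symm

variable {n m r : ℕ}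

/-! ### Powers of triangular matrices as sums over chains -/

theorem gam_eq_zero (Γ : Params r) {i l : Fin r} (h : ¬ l < i) : gam Γ i l = 0 := dif_neg h

/-- This lets sums over increasing chains be replaced by sums over all sequences, which are easier
to reindex. -/
theorem strictMono_of_prod_gam_ne_zero (Γ : Params r) {k : ℕ} {s : Fin (k + 1) → Fin r}
    (h : ∏ t : Fin k, gam Γ (s t.succ) (s t.castSucc) ≠ 0) : StrictMono s := by
  rw [Fin.strictMono_iff_lt_succ]
  intro t
  by_contra hc
  exact Finset.prod_ne_zero_iff.mp h t (Finset.mem_univ t) (gam_eq_zero Γ hc)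

/-- The contribution of the chains of length `k` from `l` to `i` to entry `(l, i)` of
`p (C(μ, Γ))`. -/
def chainPart (μ : Fin r → ℂ) (Γ : Params r) (p : ℂ[X]) (k : ℕ) (l i : Fin r) : ℂ :=
  ∑ s : Fin (k + 1) → Fin r, if s 0 = l ∧ s (Fin.last k) = i then
    (∏ t : Fin k, gam Γ (s t.succ) (s t.castSucc)) * p.divDiff (fun t => μ (s t)) else 0

theorem chainPart_zero (μ : Fin r → ℂ) (Γ : Params r) (p : ℂ[X]) (l i : Fin r) :
    chainPart μ Γ p 0 l i = if l = i then p.eval (μ i) else 0 := by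
  rw [chainPart, Fintype.sum_eq_single fun _ => l]
  · simp only [divDiff_zero, Finset.univ_eq_empty, Finset.prod_empty, one_mul,
      true_and]
    split_ifs with h
    · rw [h]
    · rfl
  · intro s hs
    refine if_neg fun h => hs (funext fun t => ?_)
    rw [Fin.fin_one_eq_zero t]
    exact h.1

/-- An increasing sequence in `Fin r` has at most `r` terms, so cutting the sum at lengths `k < r`
loses nothing. -/
theorem chainPart_eq_zero_of_le (μ : Fin r → ℂ) (Γ : Params r) (p : ℂ[X]) {k : ℕ} (hk : r ≤ k)
    (l i : Fin r) : chainPart μ Γ p k l i = 0 := by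
  refine Finset.sum_eq_zero fun s _ => ?_
  split_ifs
  · rw [mul_eq_zero]
    left
    by_contra h
    have := Fintype.card_le_of_injective s (strictMono_of_prod_gam_ne_zero Γ h).injective
    simp only [Fintype.card_fin] at this
    omega
  · rfl

theorem chainPart_succ_eq_zero (μ : Fin r → ℂ) (Γ : Params r) (p : ℂ[X]) (k : ℕ)
    {l i : Fin r} (h : ¬ l < i) : chainPart μ Γ p (k + 1) l i = 0 := by
  refine Finset.sum_eq_zero fun s _ => ?_
  split_ifs with hs
  · rw [mul_eq_zero]
    left
    by_contra hne
    have := strictMono_of_prod_gam_ne_zero Γ hne (Fin.last_pos (n := k))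
    rw [hs.1, hs.2] at this
    exact h this
  · rfl

/-- By the Leibniz rule, `X` is either evaluated at the first node `μ l` or removes that node; in
the second case the first link of the chain splits off as the factor `gam Γ j l`. -/
theorem chainPart_X_mul (μ : Fin r → ℂ) (Γ : Params r) (p : ℂ[X]) (k : ℕ) (l i : Fin r) :
    chainPart μ Γ (X * p) (k + 1) l i =
      μ l * chainPart μ Γ p (k + 1) l i + ∑ j, gam Γ j l * chainPart μ Γ p k j i := by
  have h1 : ∑ j, gam Γ j l * chainPart μ Γ p k j i =
      ∑ s : Fin (k + 2) → Fin r, if s 0 = l ∧ s (Fin.last (k + 1)) = i then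
        (∏ t : Fin (k + 1), gam Γ (s t.succ) (s t.castSucc)) *
          p.divDiff (fun t : Fin (k + 1) => μ (s t.succ)) else 0 := by
    symm
    rw [← (Fin.consEquiv fun _ : Fin (k + 2) => Fin r).sum_comp, Fintype.sum_prod_type,
      Fintype.sum_eq_single l]
    · symm
      simp only [chainPart, Finset.mul_sum]
      rw [Finset.sum_comm]
      refine Fintype.sum_congr _ _ fun u => ?_
      rw [Fintype.sum_eq_single (u 0)]
      · simp only [Fin.consEquiv_apply, Fin.cons_zero, ← Fin.succ_last, Fin.cons_succ, true_and,
          Fin.prod_univ_succ (n := k), Fin.castSucc_zero, ← Fin.succ_castSucc, mul_ite, mul_zero,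
          mul_assoc]
      · intro j hj
        rw [if_neg fun h => hj h.1.symm, mul_zero]
    · intro j hj
      refine Finset.sum_eq_zero fun u _ => if_neg fun h => hj ?_
      simpa using h.1
  rw [h1, chainPart, chainPart, Finset.mul_sum, ← Finset.sum_add_distrib]
  refine Fintype.sum_congr _ _ fun s => ?_
  split_ifs with hs
  · rw [divDiff_X_mul, hs.1]
    ring
  · simp

/-- The sum over all chains from `l` to `i`. -/
def chainTotal (μ : Fin r → ℂ) (Γ : Params r) (p : ℂ[X]) (l i : Fin r) : ℂ :=
  ∑ k ∈ Finset.range r, chainPart μ Γ p k l i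

theorem chainTotal_X_mul (μ : Fin r → ℂ) (Γ : Params r) (p : ℂ[X]) (l i : Fin r) :
    chainTotal μ Γ (X * p) l i =
      μ l * chainTotal μ Γ p l i + ∑ j, gam Γ j l * chainTotal μ Γ p j i := by
  obtain ⟨q, hq⟩ : ∃ q, r = q + 1 := ⟨r - 1, by have := l.2; omega⟩
  -- The term of top length drops out, so shifting the chain length by one keeps the range of
  -- summation.
  have hlast : ∑ j, gam Γ j l * chainPart μ Γ p q j i = 0 := by
    have := chainPart_X_mul μ Γ p q l i
    rw [chainPart_eq_zero_of_le _ _ _ hq.le, chainPart_eq_zero_of_le _ _ _ hq.le] at this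
    simpa using this.symm
  have hz : chainPart μ Γ (X * p) 0 l i = μ l * chainPart μ Γ p 0 l i := by
    rw [chainPart_zero, chainPart_zero]
    split_ifs with h
    · rw [h]; simp
    · simp
  have h2 : ∑ j, gam Γ j l * chainTotal μ Γ p j i =
      ∑ k ∈ Finset.range q, ∑ j, gam Γ j l * chainPart μ Γ p k j i := by
    rw [Finset.sum_comm]
    simp only [← Finset.mul_sum]
    have h3 : ∀ j, gam Γ j l * chainTotal μ Γ p j i =
        gam Γ j l * ∑ k ∈ Finset.range q, chainPart μ Γ p k j i +
          gam Γ j l * chainPart μ Γ p q j i := by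
      intro j
      rw [chainTotal, show Finset.range r = Finset.range (q + 1) by rw [hq],
        Finset.sum_range_succ, mul_add]
    rw [Finset.sum_congr rfl fun j _ => h3 j, Finset.sum_add_distrib, hlast, add_zero]
  rw [h2, chainTotal, chainTotal, show Finset.range r = Finset.range (q + 1) by rw [hq],
    Finset.sum_range_succ', Finset.sum_range_succ', hz, mul_add, Finset.mul_sum,
    Finset.sum_congr rfl fun k _ => chainPart_X_mul μ Γ p k l i, Finset.sum_add_distrib]
  ring

theorem chainTotal_one (μ : Fin r → ℂ) (Γ : Params r) (l i : Fin r) :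
    chainTotal μ Γ 1 l i = (1 : Matrix (Fin r) (Fin r) ℂ) l i := by
  rw [chainTotal, Finset.sum_eq_single_of_mem 0 (Finset.mem_range.mpr (by have := l.2; omega)),
    chainPart_zero, Matrix.one_apply]
  · simp
  · intro k _ hk
    obtain ⟨k, rfl⟩ := Nat.exists_eq_succ_of_ne_zero hk
    simp [chainPart, divDiff_one_succ]

theorem chainTotal_of_not_lt (μ : Fin r → ℂ) (Γ : Params r) (p : ℂ[X]) {l i : Fin r}
    (h : ¬ l < i) : chainTotal μ Γ p l i = if l = i then p.eval (μ i) else 0 := by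
  rw [chainTotal, Finset.sum_eq_single_of_mem 0 (Finset.mem_range.mpr (by have := l.2; omega)),
    chainPart_zero]
  intro k _ hk
  obtain ⟨k, rfl⟩ := Nat.exists_eq_succ_of_ne_zero hk
  exact chainPart_succ_eq_zero _ _ _ _ h

/-- `chainTotal_X_mul` is exactly left multiplication by `triC μ Γ`, read off in row `l`. -/
theorem triC_pow_apply (μ : Fin r → ℂ) (Γ : Params r) (j : ℕ) (l i : Fin r) :
    (triC μ Γ ^ j) l i = chainTotal μ Γ (X ^ j) l i := by
  induction j generalizing l with
  | zero => rw [pow_zero, pow_zero, chainTotal_one]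
  | succ j ih =>
    have hC : ∀ q, triC μ Γ l q = (if l = q then μ l else 0) + gam Γ q l := by
      intro q
      rw [triC, Matrix.of_apply]
      split_ifs with h
      · rw [gam_eq_zero Γ (by simp [h]), add_zero, h]
      · rw [zero_add]
    rw [pow_succ', pow_succ', chainTotal_X_mul, Matrix.mul_apply]
    simp only [hC, ih, add_mul, Finset.sum_add_distrib, ite_mul, zero_mul, Finset.sum_ite_eq,
      Finset.mem_univ, if_true]

/-! ### The block formula for `Q` -/

/-- The entry `(a, b)` of `P` as a polynomial. -/
def entryPoly (A : Fin (m + 1) → Matrix (Fin n) (Fin n) ℂ) (a b : Fin n) : ℂ[X] :=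
  ∑ j : Fin (m + 1), C (A j a b) * X ^ (j : ℕ)

theorem value_apply (A : Fin (m + 1) → Matrix (Fin n) (Fin n) ℂ) (z : ℂ) (a b : Fin n) :
    value A z a b = (entryPoly A a b).eval z := by
  simp only [value, entryPoly, Matrix.sum_apply, Matrix.smul_apply, smul_eq_mul, eval_finsetSum,
    eval_mul, eval_C, eval_pow, eval_X, mul_comm]

theorem matDividedDiff_apply (A : Fin (m + 1) → Matrix (Fin n) (Fin n) ℂ) {k : ℕ}
    (x : Fin (k + 1) → ℂ) (a b : Fin n) :
    matDividedDiff A x a b = (entryPoly A a b).divDiff x := by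
  rw [matDividedDiff, Matrix.of_apply, ← dividedDiff_eval]
  simp only [value_apply]

theorem chainTotal_entryPoly (A : Fin (m + 1) → Matrix (Fin n) (Fin n) ℂ) (μ : Fin r → ℂ)
    (Γ : Params r) (l i : Fin r) (a b : Fin n) :
    chainTotal μ Γ (entryPoly A a b) l i =
      ∑ j : Fin (m + 1), A j a b * chainTotal μ Γ (X ^ (j : ℕ)) l i := by
  simp only [chainTotal, Finset.mul_sum]
  rw [Finset.sum_comm]
  refine Finset.sum_congr rfl fun k _ => ?_
  simp only [chainPart, entryPoly, divDiff_finset_sum, divDiff_C_mul, Finset.mul_sum]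
  rw [Finset.sum_comm]
  refine Fintype.sum_congr _ _ fun s => ?_
  split_ifs
  · exact Fintype.sum_congr _ _ fun j => by ring
  · simp

theorem chainSum_apply (A : Fin (m + 1) → Matrix (Fin n) (Fin n) ℂ) (μ : Fin r → ℂ)
    (Γ : Params r) (i l : Fin r) (a b : Fin n) :
    chainSum A μ Γ i l a b = chainTotal μ Γ (entryPoly A a b) l i := by
  rw [chainSum, chainTotal, Matrix.sum_apply]
  refine Finset.sum_congr rfl fun k _ => ?_
  rw [Matrix.sum_apply, chainPart, Finset.sum_filter]
  refine Fintype.sum_congr _ _ fun s => ?_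
  simp only [Matrix.smul_apply, smul_eq_mul, matDividedDiff_apply]
  by_cases hs : StrictMono s
  · simp [hs]
  · have : ∏ t : Fin k, gam Γ (s t.succ) (s t.castSucc) = 0 := by
      by_contra hne
      exact hs (strictMono_of_prod_gam_ne_zero Γ hne)
    simp [hs, this]

theorem blockQ_apply (A : Fin (m + 1) → Matrix (Fin n) (Fin n) ℂ) (μ : Fin r → ℂ)
    (Γ : Params r) (p q : Fin r × Fin n) :
    blockQ A μ Γ p q = chainTotal μ Γ (entryPoly A p.2 q.2) q.1 p.1 := by
  rw [blockQ, Matrix.of_apply]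
  split_ifs with h1 h2
  · rw [chainSum_apply]
  · rw [chainTotal_of_not_lt _ _ _ h1, if_pos h2.symm, value_apply]
  · rw [chainTotal_of_not_lt _ _ _ h1, if_neg (Ne.symm h2)]

theorem kronQ_eq_blockQ (A : Fin (m + 1) → Matrix (Fin n) (Fin n) ℂ) (μ : Fin r → ℂ)
    (Γ : Params r) : kronQ A μ Γ = blockQ A μ Γ := by
  ext p q
  rw [blockQ_apply, chainTotal_entryPoly, kronQ, Matrix.sum_apply]
  refine Fintype.sum_congr _ _ fun j => ?_
  rw [Matrix.kronecker_apply, Matrix.transpose_apply, triC_pow_apply, mul_comm]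

end MatPoly

end

/-! ### Kernels of matrix polynomials evaluated at an endomorphism -/

section PolyAct

open Polynomial Module

variable {K Y ι : Type*} [Field K] [AddCommGroup Y] [Module K Y] [Fintype ι]

/-- The action of a matrix polynomial `M` on `ι → Y`, where `X` acts on `Y` by `T`. -/
noncomputable def polyAct (T : End K Y) (M : Matrix ι ι K[X]) : (ι → Y) →ₗ[K] (ι → Y) :=
  LinearMap.pi fun a => ∑ b, (aeval T (M a b)) ∘ₗ LinearMap.proj b

theorem polyAct_apply (T : End K Y) (M : Matrix ι ι K[X]) (x : ι → Y) (a : ι) :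
    polyAct T M x a = ∑ b, aeval T (M a b) (x b) := by
  simp [polyAct]

theorem polyAct_mul (T : End K Y) (M N : Matrix ι ι K[X]) (x : ι → Y) :
    polyAct T (M * N) x = polyAct T M (polyAct T N x) := by
  ext a
  simp only [polyAct_apply, Matrix.mul_apply, map_sum, map_mul, LinearMap.sum_apply,
    End.mul_apply]
  exact Finset.sum_comm

/-- Rank-nullity for the map `F → F₁ / Z` induced by `f`. -/
theorem finrank_add_le_finrank_inf_comap {E : Type*} [AddCommGroup E] [Module K E]
    [FiniteDimensional K E] (f : E →ₗ[K] E) {F F₁ Z : Submodule K E} (hf : ∀ x ∈ F, f x ∈ F₁)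
    (hZ : Z ≤ F₁) :
    finrank K F + finrank K Z ≤ finrank K F₁ + finrank K (F ⊓ Z.comap f : Submodule K E) := by
  let g : F →ₗ[K] F₁ := f.restrict hf
  let Z' : Submodule K F₁ := Z.comap F₁.subtype
  have h1 := (Z'.mkQ ∘ₗ g).finrank_range_add_finrank_ker
  have h2 := Submodule.finrank_le (LinearMap.range (Z'.mkQ ∘ₗ g))
  have h3 := Z'.finrank_quotient_add_finrank
  have h4 : finrank K Z' = finrank K Z :=
    (Submodule.comapSubtypeEquivOfLe hZ).finrank_eq
  have h5 : finrank K (LinearMap.ker (Z'.mkQ ∘ₗ g)) ≤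
      finrank K (F ⊓ Z.comap f : Submodule K E) := by
    rw [LinearEquiv.finrank_eq ((LinearMap.ker (Z'.mkQ ∘ₗ g)).equivMapOfInjective F.subtype
      F.injective_subtype)]
    refine Submodule.finrank_mono ?_
    rintro _ ⟨x, hx, rfl⟩
    refine ⟨x.2, ?_⟩
    simpa [Z', g] using hx
  omega

variable [DecidableEq ι]

/-- If `M(μ)` kills a vector `v`, then a factor of determinant `X - μ` splits off from `M`. -/
theorem exists_eq_mul_of_mulVec_eq_zero (M : Matrix ι ι K[X]) {μ : K} {v l : ι → K}
    (hv : (M.map (eval μ)) *ᵥ v = 0) (hl : l ⬝ᵥ v = 1) :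
    ∃ M' : Matrix ι ι K[X],
      M = M' * (1 + (X - C μ - 1) • (Matrix.vecMulVec v l).map C) ∧
      M.det = M'.det * (X - C μ) := by
  have hdvd : ∀ a, (X - C μ) ∣ (M *ᵥ (C ∘ v)) a := by
    intro a
    rw [dvd_iff_isRoot, IsRoot, Matrix.mulVec, dotProduct, eval_finsetSum]
    simpa [Matrix.mulVec, dotProduct] using congrFun hv a
  choose w hw using hdvd
  set p : Matrix ι ι K[X] := (Matrix.vecMulVec v l).map C with hp
  have hp' : p = Matrix.vecMulVec (C ∘ v) (C ∘ l) := by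
    ext a b : 2
    simp [hp, Matrix.vecMulVec_apply]
  have hlv : (C ∘ l : ι → K[X]) ⬝ᵥ (C ∘ v) = 1 := by
    have := congrArg C hl
    simpa [dotProduct] using this
  set q : Matrix ι ι K[X] := Matrix.vecMulVec w (C ∘ l) with hq
  have hqp : q * p = q := by
    rw [hq, hp', Matrix.vecMulVec_mul_vecMulVec, hlv]
    simp
  have hpp : p * p = p := by
    rw [hp', Matrix.vecMulVec_mul_vecMulVec, hlv]
    simp
  have hMp : M * p = (X - C μ) • q := by
    rw [hp', Matrix.mul_vecMulVec, hq]
    ext a b : 2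
    simp only [Matrix.vecMulVec_apply, Matrix.smul_apply, smul_eq_mul]
    rw [hw, mul_assoc]
  -- Since `p = v lᵀ` is idempotent, the right factor is `(1 - p) + (X - μ) p`. The quotient is `M`
  -- on the kernel of `p` and `M p / (X - μ) = q` on its range.
  have hM : M = (M - M * p + q) * (1 + (X - C μ - 1) • p) := by
    rw [mul_add, mul_one, Matrix.mul_smul, add_mul, sub_mul, mul_assoc, hpp, hqp, sub_self,
      zero_add, hMp, sub_smul _ (1 : K[X]), one_smul]
    abel
  refine ⟨M - M * p + q, hM, ?_⟩
  conv_lhs => rw [hM]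
  rw [Matrix.det_mul]
  congr 1
  have : (X - C μ - 1) • p =
      Matrix.vecMulVec ((X - C μ - 1) • (C ∘ v : ι → K[X])) (C ∘ l) := by
    rw [hp', Matrix.smul_vecMulVec]
  rw [this, Matrix.vecMulVec_eq Unit, Matrix.det_one_add_replicateCol_mul_replicateRow,
    dotProduct_smul, hlv]
  simp

/-- The factor acts as the projection `1 - v lᵀ` plus `T - μ` on the component along `v`; the latter
moves one step down the flag. -/
theorem polyAct_one_add_smul (T : End K Y) (μ : K) (v l : ι → K) (x : ι → Y) (a : ι) :
    polyAct T (1 + (X - C μ - 1) • (Matrix.vecMulVec v l).map C) x a =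
      (x a - v a • ∑ b, l b • x b) +
        v a • (T (∑ b, l b • x b) - μ • ∑ b, l b • x b) := by
  rw [polyAct_apply]
  have h : ∀ b, aeval T ((1 + (X - C μ - 1) • (Matrix.vecMulVec v l).map C : Matrix ι ι K[X]) a b)
      (x b) = (if a = b then x b else 0) +
        v a • (T (l b • x b) - μ • (l b • x b) - l b • x b) := by
    intro b
    simp only [Matrix.add_apply, Matrix.one_apply, Matrix.smul_apply, Matrix.map_apply,
      Matrix.vecMulVec_apply, smul_eq_mul, map_add, map_mul, map_sub, aeval_X, aeval_C, map_one,
      LinearMap.add_apply, End.mul_apply, LinearMap.sub_apply, Module.algebraMap_end_apply,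
      End.one_apply, map_smul, smul_sub]
    congr 1
    · split_ifs <;> simp
    · simp only [smul_smul, mul_comm, mul_left_comm]
  simp only [h, Finset.sum_add_distrib, Finset.sum_ite_eq, Finset.mem_univ, if_true,
    ← Finset.smul_sum, Finset.sum_sub_distrib, ← map_sum, smul_sub]
  abel

/-- If `T` is triangular along the flag `W` with diagonal `μ` and `∏ (X - μₖ)` divides `det M`,
then the kernel of the action of `M` has dimension at least the length of the flag. -/
theorem le_finrank_ker_polyAct [FiniteDimensional K Y] (T : End K Y) (r : ℕ)
    (W : ℕ → Submodule K Y) (μ : ℕ → K) (hlt : ∀ k < r, W (k + 1) < W k)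
    (hT : ∀ k < r, ∀ y ∈ W k, T y - μ k • y ∈ W (k + 1)) (M : Matrix ι ι K[X])
    (hM : ∏ k ∈ Finset.range r, (X - C (μ k)) ∣ M.det) :
    r ≤ finrank K (Submodule.pi Set.univ (fun _ : ι => W 0) ⊓ LinearMap.ker (polyAct T M) :
      Submodule K (ι → Y)) := by
  induction r generalizing W μ M with
  | zero => exact Nat.zero_le _
  | succ r ih =>
    have hroot : (M.map (eval (μ 0))).det = 0 := by
      have h1 : (X - C (μ 0)) ∣ M.det :=
        (Finset.dvd_prod_of_mem (fun k => X - C (μ k))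
          (Finset.mem_range.mpr (Nat.succ_pos r))).trans hM
      have h2 := dvd_iff_isRoot.mp h1
      rw [IsRoot, ← coe_evalRingHom, RingHom.map_det] at h2
      exact h2
    obtain ⟨v, hv0, hv⟩ := Matrix.exists_mulVec_eq_zero_iff.mpr hroot
    obtain ⟨a, ha⟩ := Function.ne_iff.mp hv0
    set l : ι → K := Pi.single a (v a)⁻¹ with hl
    have hlv : l ⬝ᵥ v = 1 := by rw [hl, single_dotProduct, inv_mul_cancel₀ ha]
    obtain ⟨M', hM', hdet⟩ := exists_eq_mul_of_mulVec_eq_zero M hv hlv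
    set D : Matrix ι ι K[X] := 1 + (X - C (μ 0) - 1) • (Matrix.vecMulVec v l).map C with hD
    have hdvd' : ∏ k ∈ Finset.range r, (X - C (μ (k + 1))) ∣ M'.det := by
      rw [hdet, Finset.prod_range_succ'] at hM
      exact (mul_dvd_mul_iff_right (X_sub_C_ne_zero (μ 0))).mp hM
    have hih := ih (fun k => W (k + 1)) (fun k => μ (k + 1)) (fun k hk => hlt (k + 1) (by omega))
      (fun k hk => hT (k + 1) (by omega)) M' hdvd'
    have h10 : W 1 < W 0 := hlt 0 (Nat.succ_pos r)
    set F₀ : Submodule K (ι → Y) := Submodule.pi Set.univ fun _ => W 0 with hF₀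
    set F₁ : Submodule K (ι → Y) := Submodule.pi Set.univ fun _ => W 1 with hF₁
    let φ : (ι → Y) →ₗ[K] (ι → Y) := LinearMap.pi fun a =>
      LinearMap.proj a - v a • ∑ b, l b • LinearMap.proj b
    have hφ : ∀ x a, φ x a = x a - v a • ∑ b, l b • x b := by
      intro x a
      simp [φ]
    -- `F` requires membership in the smaller flag space only off the direction `v`. It strictly
    -- contains `F₁`, which yields the extra dimension of the induction, while the linear factor `D`
    -- still maps it into `F₁`.
    set F : Submodule K (ι → Y) := F₀ ⊓ F₁.comap φ with hF
    have mem₀ : ∀ {x}, x ∈ F₀ ↔ ∀ a, x a ∈ W 0 := by intro x; simp [hF₀]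
    have mem₁ : ∀ {x}, x ∈ F₁ ↔ ∀ a, x a ∈ W 1 := by intro x; simp [hF₁]
    have hFlt : F₁ < F := by
      refine lt_of_le_of_ne (fun x hx => ⟨?_, ?_⟩) ?_
      · exact mem₀.mpr fun a => h10.le (mem₁.mp hx a)
      · refine mem₁.mpr fun a => ?_
        rw [hφ]
        exact sub_mem (mem₁.mp hx a) ((W 1).smul_mem _
          (sum_mem fun b _ => (W 1).smul_mem _ (mem₁.mp hx b)))
      · intro he
        obtain ⟨y, hy0, hy1⟩ := SetLike.exists_of_lt h10
        have hx : (fun a => v a • y) ∈ F := by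
          refine ⟨mem₀.mpr fun a => (W 0).smul_mem _ hy0, mem₁.mpr fun a => ?_⟩
          have e : ∑ b, l b • v b • y = y := by
            simp only [smul_smul, ← Finset.sum_smul]
            change (l ⬝ᵥ v) • y = y
            rw [hlv, one_smul]
          rw [hφ, e, sub_self]
          exact zero_mem _
        rw [← he] at hx
        exact hy1 (((W 1).smul_mem_iff ha).mp (mem₁.mp hx a))
    have hfin := Submodule.finrank_lt_finrank_of_lt hFlt
    have hmap : ∀ x ∈ F, polyAct T D x ∈ F₁ := by
      intro x hx
      refine mem₁.mpr fun a => ?_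
      rw [polyAct_one_add_smul, ← hφ]
      refine add_mem (mem₁.mp hx.2 a) ((W 1).smul_mem _ (hT 0 (Nat.succ_pos r) _ ?_))
      exact sum_mem fun b _ => (W 0).smul_mem _ (mem₀.mp hx.1 b)
    have hdim := finrank_add_le_finrank_inf_comap (polyAct T D) hmap
      (inf_le_left : F₁ ⊓ LinearMap.ker (polyAct T M') ≤ F₁)
    have hle : F ⊓ (F₁ ⊓ LinearMap.ker (polyAct T M')).comap (polyAct T D) ≤
        F₀ ⊓ LinearMap.ker (polyAct T M) := by
      rintro x ⟨hx, hx2⟩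
      refine ⟨hx.1, ?_⟩
      change polyAct T M x = 0
      rw [hM', polyAct_mul]
      exact hx2.2
    have := Submodule.finrank_mono hle
    change r ≤ finrank K (F₁ ⊓ LinearMap.ker (polyAct T M') : Submodule K (ι → Y)) at hih
    omega

end PolyAct

noncomputable section

namespace MatPoly

open Polynomial Module

/-! ### Lower bound for perturbations -/

theorem svSmallest_le {ι : Type*} [Fintype ι] [DecidableEq ι] {M : Matrix ι ι ℂ} {k : ℕ} {c : ℝ}
    (hk : 0 < k) (hkι : k ≤ Fintype.card ι) (W : Submodule ℂ (ι → ℂ)) (hW : k ≤ finrank ℂ W)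
    (h : ∀ x ∈ W, ‖WithLp.toLp 2 (M *ᵥ x)‖ ≤ c * ‖WithLp.toLp 2 x‖) : svSmallest k M ≤ c := by
  let e := (WithLp.linearEquiv 2 ℂ (ι → ℂ)).symm
  have hfr : finrank ℂ (W.map (e : (ι → ℂ) →ₗ[ℂ] EuclideanSpace ℂ ι)) = finrank ℂ W :=
    LinearEquiv.finrank_map_eq e W
  refine LinearMap.singularValues_le _ (W.map (e : (ι → ℂ) →ₗ[ℂ] EuclideanSpace ℂ ι)) ?_ ?_ ?_
  · rw [finrank_euclideanSpace]
    omega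
  · rw [finrank_euclideanSpace, hfr]
    omega
  · rintro _ ⟨x, hx, rfl⟩
    exact h x hx

variable {n m r : ℕ}

theorem norm_sq_toLp_vec (V : Matrix (Fin n) (Fin r) ℂ) :
    ‖WithLp.toLp 2 V.vec‖ ^ 2 = ∑ i, ‖WithLp.toLp 2 (V.col i)‖ ^ 2 := by
  simp only [EuclideanSpace.norm_sq_eq, Fintype.sum_prod_type]
  rfl

theorem norm_toLp_mulVec_le (D : Matrix (Fin n) (Fin n) ℂ) (x : Fin n → ℂ) :
    ‖WithLp.toLp 2 (D *ᵥ x)‖ ≤ specNorm D * ‖WithLp.toLp 2 x‖ :=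
  (Matrix.toEuclideanCLM (𝕜 := ℂ) D).le_opNorm (WithLp.toLp 2 x)

theorem specNorm_nonneg (D : Matrix (Fin n) (Fin n) ℂ) : 0 ≤ specNorm D := norm_nonneg _

/-- The Euclidean norm of `vec` is the Frobenius norm, so the estimate can be made column by column.
-/
theorem norm_toLp_vec_mul_le (D : Matrix (Fin n) (Fin n) ℂ) (V : Matrix (Fin n) (Fin r) ℂ) :
    ‖WithLp.toLp 2 (D * V).vec‖ ≤ specNorm D * ‖WithLp.toLp 2 V.vec‖ := by
  refine le_of_sq_le_sq ?_ (mul_nonneg (specNorm_nonneg D) (norm_nonneg _))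
  rw [mul_pow, norm_sq_toLp_vec, norm_sq_toLp_vec, Finset.mul_sum]
  refine Finset.sum_le_sum fun i _ => ?_
  rw [← mul_pow]
  exact pow_le_pow_left₀ (norm_nonneg _) (norm_toLp_mulVec_le D (V.col i)) 2

theorem kronQ_mulVec_vec (A : Fin (m + 1) → Matrix (Fin n) (Fin n) ℂ) (μ : Fin r → ℂ)
    (Γ : Params r) (V : Matrix (Fin n) (Fin r) ℂ) :
    kronQ A μ Γ *ᵥ V.vec = (∑ j : Fin (m + 1), A j * V * triC μ Γ ^ (j : ℕ)).vec := by
  rw [kronQ, Matrix.sum_mulVec, Matrix.vec_sum]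
  refine Fintype.sum_congr _ _ fun j => ?_
  rw [Matrix.kronecker_mulVec_vec, Matrix.transpose_transpose]

/-- The matrix polynomial `P(λ) + Δ`. -/
def pertMat (A : Fin (m + 1) → Matrix (Fin n) (Fin n) ℂ) (Δ : Matrix (Fin n) (Fin n) ℂ) :
    Matrix (Fin n) (Fin n) ℂ[X] :=
  (∑ j : Fin (m + 1), (X : ℂ[X]) ^ (j : ℕ) • (A j).map C) + Δ.map C

/-- The rows of `V` are the coordinates on which `X` acts, by right multiplication with `B`. This
identifies the abstract action with the matrix form of `Q` plus `Δ`. -/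
theorem polyAct_pertMat (A : Fin (m + 1) → Matrix (Fin n) (Fin n) ℂ)
    (Δ : Matrix (Fin n) (Fin n) ℂ) (B : Matrix (Fin r) (Fin r) ℂ) (V : Fin n → Fin r → ℂ) :
    Matrix.of (polyAct (Matrix.vecMulLinear B) (pertMat A Δ) V) =
      (∑ j : Fin (m + 1), A j * Matrix.of V * B ^ (j : ℕ)) + Δ * Matrix.of V := by
  have hpow : ∀ (j : ℕ) (y : Fin r → ℂ), (Matrix.vecMulLinear B ^ j) y = y ᵥ* B ^ j := by
    intro j
    induction j with
    | zero => intro y; simp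
    | succ j ih =>
      intro y
      rw [pow_succ', End.mul_apply, ih, Matrix.vecMulLinear_apply, Matrix.vecMul_vecMul, pow_succ]
  ext a i
  rw [Matrix.of_apply, polyAct_apply]
  simp only [pertMat, Matrix.add_apply, Matrix.sum_apply, Matrix.smul_apply, Matrix.map_apply,
    smul_eq_mul, map_add, map_sum, map_mul, map_pow, aeval_X, aeval_C, LinearMap.add_apply,
    LinearMap.sum_apply, End.mul_apply, Module.algebraMap_end_apply, hpow, Finset.sum_add_distrib,
    Pi.add_apply, Finset.sum_apply, Pi.smul_apply]
  congr 1
  · rw [Finset.sum_comm]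
    refine Fintype.sum_congr _ _ fun j => ?_
    rw [Matrix.mul_assoc, Matrix.mul_apply]
    refine Fintype.sum_congr _ _ fun b => ?_
    rw [Matrix.smul_vecMul]
    rfl

theorem triC_apply_of_lt (μ : Fin r → ℂ) (Γ : Params r) {l i : Fin r} (h : i < l) :
    triC μ Γ l i = 0 := by
  rw [triC, Matrix.of_apply, if_neg h.ne', gam_eq_zero Γ h.asymm]

theorem triC_apply_self (μ : Fin r → ℂ) (Γ : Params r) (i : Fin r) : triC μ Γ i i = μ i := by
  rw [triC, Matrix.of_apply, if_pos rfl]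

/-- The functions on `Fin r` that vanish on the first `k` indices. -/
def tailSpace (r k : ℕ) : Submodule ℂ (Fin r → ℂ) where
  carrier := {y | ∀ i : Fin r, (i : ℕ) < k → y i = 0}
  add_mem' hx hy i hi := by simp [hx i hi, hy i hi]
  zero_mem' _ _ := rfl
  smul_mem' a x hx i hi := by simp [hx i hi]

/-- Right multiplication by an upper triangular matrix preserves the flag of tails and acts on its
successive quotients by the diagonal entries, so `le_finrank_ker_polyAct` applies for every `Γ`. -/
theorem le_finrank_ker_pertMat (A : Fin (m + 1) → Matrix (Fin n) (Fin n) ℂ)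
    (Δ : Matrix (Fin n) (Fin n) ℂ) (μ : Fin r → ℂ) (Γ : Params r)
    (h : ∏ i, (X - C (μ i)) ∣ pertDet A Δ) :
    r ≤ finrank ℂ (LinearMap.ker (polyAct (Matrix.vecMulLinear (triC μ Γ)) (pertMat A Δ))) := by
  set μ' : ℕ → ℂ := fun k => if hk : k < r then μ ⟨k, hk⟩ else 0 with hμ'
  have hprod : ∏ k ∈ Finset.range r, (X - C (μ' k)) = ∏ i, (X - C (μ i)) := by
    rw [← Fin.prod_univ_eq_prod_range (fun k => X - C (μ' k))]
    exact Fintype.prod_congr _ _ fun i => by simp [hμ']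
  refine (le_finrank_ker_polyAct (Matrix.vecMulLinear (triC μ Γ)) r (tailSpace r) μ' ?_ ?_
    (pertMat A Δ) (hprod ▸ h)).trans (Submodule.finrank_mono inf_le_right)
  · intro k hk
    refine lt_of_le_of_ne (fun y hy i hi => hy i (by omega)) fun he => ?_
    have h1 : (Pi.single ⟨k, hk⟩ 1 : Fin r → ℂ) ∈ tailSpace r k := by
      intro i hi
      exact Pi.single_eq_of_ne (fun h => by simp [h] at hi) _
    rw [← he] at h1
    simpa using h1 ⟨k, hk⟩ (by simp)
  · intro k hk y hy i hi
    have hsum : (y ᵥ* triC μ Γ) i = y i * μ i := by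
      rw [Matrix.vecMul, dotProduct, Finset.sum_eq_single i, triC_apply_self]
      · intro l _ hl
        rcases lt_or_gt_of_ne hl with h1 | h1
        · rw [hy l (by have : (l : ℕ) < i := h1; omega), zero_mul]
        · rw [triC_apply_of_lt μ Γ h1, mul_zero]
      · simp
    rw [Pi.sub_apply, Pi.smul_apply, Matrix.vecMulLinear_apply, hsum, smul_eq_mul]
    rcases (Nat.lt_succ_iff.mp hi).lt_or_eq with h1 | h1
    · rw [hy i h1]
      ring
    · have : μ' k = μ i := by
        simp only [hμ', ← h1, i.2, dif_pos]
      rw [this]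
      ring

theorem svSmallest_blockQ_le_specNorm (hn : 0 < n) (hr : 0 < r)
    (A : Fin (m + 1) → Matrix (Fin n) (Fin n) ℂ)
    (Δ : Matrix (Fin n) (Fin n) ℂ) (μ : Fin r → ℂ) (Γ : Params r)
    (h : ∏ i, (X - C (μ i)) ∣ pertDet A Δ) : svSmallest r (blockQ A μ Γ) ≤ specNorm Δ := by
  let e : (Fin n → Fin r → ℂ) →ₗ[ℂ] (Fin r × Fin n → ℂ) :=
    { toFun := fun V => (Matrix.of V).vec
      map_add' := fun _ _ => rfl
      map_smul' := fun _ _ => rfl }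
  have he : Function.Injective e :=
    fun V W hVW => Matrix.of.injective (Matrix.vec_inj.mp hVW)
  set N := LinearMap.ker (polyAct (Matrix.vecMulLinear (triC μ Γ)) (pertMat A Δ))
  have hN : finrank ℂ (N.map e) = finrank ℂ N := 
    (N.equivMapOfInjective e he).finrank_eq.symm
  refine svSmallest_le hr ?_ (N.map e) ?_ ?_
  · simpa using Nat.le_mul_of_pos_right r hn
  · rw [hN]
    exact le_finrank_ker_pertMat A Δ μ Γ h
  · rintro _ ⟨V, hV, rfl⟩
    have hV : polyAct (Matrix.vecMulLinear (triC μ Γ)) (pertMat A Δ) V = 0 := hV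
    have hV' := polyAct_pertMat A Δ (triC μ Γ) V
    rw [hV, Matrix.of_zero] at hV'
    -- On the kernel `Q` coincides with `-Δ` acting on columns, so its growth there is at most
    -- `‖Δ‖`.
    have h1 : kronQ A μ Γ *ᵥ (Matrix.of V).vec = -(Δ * Matrix.of V).vec := by
      rw [kronQ_mulVec_vec, eq_neg_of_add_eq_zero_left hV'.symm, Matrix.vec_neg]
    change ‖WithLp.toLp 2 (blockQ A μ Γ *ᵥ (Matrix.of V).vec)‖ ≤
      _ * ‖WithLp.toLp 2 (Matrix.of V).vec‖
    rw [← kronQ_eq_blockQ, h1, WithLp.toLp_neg, norm_neg]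
    exact norm_toLp_vec_mul_le Δ (Matrix.of V)

end MatPoly

end

/-! ### Differences of powers in a noncommutative algebra -/

section PowDiff

variable {K R : Type*} [CommRing K] [Ring R] [Algebra K R]

/-- `∑_{a + b = j - 1} Xᵃ E Yᵇ`. -/
def powDiff (X Y E : R) : ℕ → R
  | 0 => 0
  | j + 1 => powDiff X Y E j * Y + X ^ j * E

theorem pow_add_smul_eq (t : K) (Y E : R) (j : ℕ) :
    (Y + t • E) ^ j = Y ^ j + t • powDiff (Y + t • E) Y E j := by
  induction j with
  | zero => simp [powDiff]
  | succ j ih =>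
    have h : (Y + t • E) ^ (j + 1) = (Y + t • E) ^ j * Y + t • ((Y + t • E) ^ j * E) := by
      rw [pow_succ, mul_add, mul_smul_comm]
    rw [h, powDiff, smul_add, ← add_assoc, ← smul_mul_assoc t (powDiff _ _ _ _), pow_succ Y,
      ← add_mul, ← ih]

/-- The sum `∑ Yᵃ M Yᵇ` telescopes. With `M = U* Aⱼ V` this connects the first-order conditions to
the Gram matrices of `U` and `V`. -/
theorem powDiff_commutator (Y M : R) (j : ℕ) :
    powDiff Y Y M j * Y - Y * powDiff Y Y M j = M * Y ^ j - Y ^ j * M := by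
  induction j with
  | zero => simp [powDiff]
  | succ j ih =>
    have h : powDiff Y Y M (j + 1) * Y - Y * powDiff Y Y M (j + 1) =
        (powDiff Y Y M j * Y - Y * powDiff Y Y M j) * Y + Y ^ j * M * Y - Y ^ (j + 1) * M := by
      rw [powDiff, pow_succ']
      noncomm_ring
    rw [h, ih, pow_succ]
    noncomm_ring

theorem powDiff_mul_left (Y M : R) (j : ℕ) : powDiff Y Y (Y * M) j = Y * powDiff Y Y M j := by
  induction j with
  | zero => simp [powDiff]
  | succ j ih =>
    rw [powDiff, powDiff, ih, mul_add, mul_assoc, ← mul_assoc (Y ^ j), ← mul_assoc Y (Y ^ j),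
      ← pow_succ, ← pow_succ']

theorem continuous_powDiff {α : Type*} [TopologicalSpace α] [TopologicalSpace R]
    [IsTopologicalRing R] {X : α → R} (hX : Continuous X) (Y E : R) (j : ℕ) :
    Continuous fun t => powDiff (X t) Y E j := by
  induction j with
  | zero => exact continuous_const
  | succ j ih =>
    simp only [powDiff]
    fun_prop

/-- Cyclicity of the trace moves the direction `E` outside, exhibiting the gradient as a matrix
independent of `E`. -/
theorem trace_mul_powDiff {ι : Type*} [Fintype ι] [DecidableEq ι] (Y M E : Matrix ι ι K) (j : ℕ) :
    (M * powDiff Y Y E j).trace = (powDiff Y Y M j * E).trace := by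
  induction j generalizing M with
  | zero => simp [powDiff]
  | succ j ih =>
    have h : powDiff Y Y M (j + 1) = Y * powDiff Y Y M j + M * Y ^ j := by
      rw [powDiff, ← sub_eq_iff_eq_add', add_sub_right_comm, powDiff_commutator]
      abel
    rw [h, powDiff, mul_add, add_mul, Matrix.trace_add, Matrix.trace_add, ← mul_assoc,
      Matrix.trace_mul_comm (M * powDiff Y Y E j), ← mul_assoc, ih, powDiff_mul_left, mul_assoc M]

end PowDiff

/-! ### Full rank and commutators of triangular matrices -/

theorem Matrix.det_ne_zero_of_rank_eq {K ι : Type*} [Field K] [Fintype ι] [DecidableEq ι]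
    {M : Matrix ι ι K} (h : M.rank = Fintype.card ι) : M.det ≠ 0 := by
  have hs : LinearMap.range M.mulVecLin = ⊤ := by
    apply Submodule.eq_top_of_finrank_eq
    rw [Module.finrank_fintype_fun_eq_card]
    exact h
  have hinj := LinearMap.injective_iff_surjective.mpr (LinearMap.range_eq_top.mp hs)
  intro hdet
  obtain ⟨v, hv0, hv⟩ := Matrix.exists_mulVec_eq_zero_iff.mpr hdet
  exact hv0 (hinj (by rw [Matrix.mulVecLin_apply, hv, map_zero]))

/-- The two products have the same diagonal, so the commutator is strictly upper triangular; being
Hermitian kills the rest. -/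
theorem Matrix.eq_zero_of_isHermitian_commutator {r : ℕ} {B Y : Matrix (Fin r) (Fin r) ℂ}
    (hB : ∀ i l, l < i → B i l = 0) (hY : ∀ i l, l < i → Y i l = 0)
    (h : (B * Y - Y * B).IsHermitian) : B * Y - Y * B = 0 := by
  have key : ∀ {M N : Matrix (Fin r) (Fin r) ℂ}, (∀ i l, l < i → M i l = 0) →
      (∀ i l, l < i → N i l = 0) → ∀ i l, l ≤ i → (M * N) i l = if l = i then M i i * N i i else 0 := by
    intro M N hM hN i l hl
    rw [Matrix.mul_apply]
    split_ifs with hli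
    · subst hli
      refine Finset.sum_eq_single l (fun q _ hq => ?_) (by simp)
      rcases lt_or_gt_of_ne hq with h1 | h1
      · rw [hM l q h1, zero_mul]
      · rw [hN q l h1, mul_zero]
    · have hlt := lt_of_le_of_ne hl hli
      refine Finset.sum_eq_zero fun q _ => ?_
      rcases lt_or_ge q i with h1 | h1
      · rw [hM i q h1, zero_mul]
      · rw [hN q l (hlt.trans_le h1), mul_zero]
  have low : ∀ i l, l ≤ i → (B * Y - Y * B) i l = 0 := by
    intro i l hl
    rw [Matrix.sub_apply, key hB hY i l hl, key hY hB i l hl]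
    split_ifs <;> ring
  ext i l
  rcases le_total l i with hl | hl
  · exact low i l hl
  · rw [← h.apply, low l i hl, star_zero]
    rfl

noncomputable section

namespace MatPoly

open Polynomial Module

variable {n m r : ℕ}

/-! ### First-order optimality -/

theorem triC_add_smul (μ : Fin r → ℂ) (Γ Θ : Params r) (t : ℂ) :
    triC μ (Γ + t • Θ) = triC μ Γ + t • triC 0 Θ := by
  ext l i
  simp only [triC, Matrix.add_apply, Matrix.of_apply, Matrix.smul_apply, gam]
  split_ifs <;> simp

theorem triC_zero_smul (Θ : Params r) (c : ℂ) : triC 0 (c • Θ) = c • triC 0 Θ := by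
  ext l i
  simp only [triC, Matrix.of_apply, Matrix.smul_apply, gam]
  split_ifs <;> simp

theorem triC_zero_single {i l : Fin r} (h : l < i) :
    triC 0 (Pi.single ⟨(i, l), h⟩ 1) = Matrix.single l i (1 : ℂ) := by
  ext l' i'
  simp only [triC, Matrix.of_apply, gam, Matrix.single_apply, Pi.zero_apply]
  split_ifs with h1 h2 h3 h4 h5
  · exact absurd (h2.1.trans (h1.trans h2.2.symm)) h.ne
  · rfl
  · obtain ⟨rfl, rfl⟩ := h4
    simp
  · refine Pi.single_eq_of_ne (fun he => h4 ?_) _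
    simp only [Subtype.mk.injEq, Prod.mk.injEq] at he
    exact ⟨he.2.symm, he.1.symm⟩
  · exact absurd (h5.1 ▸ h5.2 ▸ h) h3
  · rfl

/-- The difference quotient of `Q(μ, Γ + t Θ, P)` in `t`. -/
def slopeQ (A : Fin (m + 1) → Matrix (Fin n) (Fin n) ℂ) (μ : Fin r → ℂ) (Γ Θ : Params r) (t : ℂ) :
    Matrix (Fin r × Fin n) (Fin r × Fin n) ℂ :=
  ∑ j : Fin (m + 1), (powDiff (triC μ (Γ + t • Θ)) (triC μ Γ) (triC 0 Θ) j)ᵀ ⊗ₖ A j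

theorem kronQ_add_smul (A : Fin (m + 1) → Matrix (Fin n) (Fin n) ℂ) (μ : Fin r → ℂ)
    (Γ Θ : Params r) (t : ℂ) :
    kronQ A μ (Γ + t • Θ) = kronQ A μ Γ + t • slopeQ A μ Γ Θ t := by
  rw [kronQ, kronQ, slopeQ, Finset.smul_sum, ← Finset.sum_add_distrib]
  refine Fintype.sum_congr _ _ fun j => ?_
  rw [triC_add_smul, pow_add_smul_eq, Matrix.transpose_add, Matrix.transpose_smul,
    Matrix.add_kronecker, Matrix.smul_kronecker]

theorem continuous_triC (μ : Fin r → ℂ) : Continuous fun Γ : Params r => triC μ Γ := by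
  refine continuous_matrix fun l i => ?_
  simp only [triC, Matrix.of_apply, gam]
  split_ifs <;> fun_prop

theorem continuous_kronecker_right {p : Type*} [Fintype p] (B : Matrix (Fin n) (Fin n) ℂ) :
    Continuous fun M : Matrix p p ℂ => M ⊗ₖ B := by
  refine continuous_matrix fun x y => ?_
  exact (continuous_id.matrix_elem x.1 y.1).mul continuous_const

theorem continuous_slopeQ (A : Fin (m + 1) → Matrix (Fin n) (Fin n) ℂ) (μ : Fin r → ℂ)
    (Γ Θ : Params r) : Continuous (slopeQ A μ Γ Θ) := by
  refine continuous_finsetSum _ fun j _ => (continuous_kronecker_right (A j)).comp ?_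
  refine Continuous.matrix_transpose (continuous_powDiff ?_ _ _ _)
  exact (continuous_triC μ).comp (by fun_prop)

theorem continuous_kronQ (A : Fin (m + 1) → Matrix (Fin n) (Fin n) ℂ) (μ : Fin r → ℂ) :
    Continuous fun Γ : Params r => kronQ A μ Γ := by
  refine continuous_finsetSum _ fun j _ => (continuous_kronecker_right (A j)).comp ?_
  exact Continuous.matrix_transpose ((continuous_triC μ).pow j)

theorem continuous_toEuclideanCLM {ι : Type*} [Fintype ι] [DecidableEq ι] :
    Continuous fun M : Matrix ι ι ℂ => Matrix.toEuclideanCLM (n := ι) (𝕜 := ℂ) M :=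
  LinearMap.continuous_of_finiteDimensional
    (Matrix.toEuclideanCLM (n := ι) (𝕜 := ℂ)).toAlgEquiv.toLinearMap

theorem slopeQ_mulVec_vec (A : Fin (m + 1) → Matrix (Fin n) (Fin n) ℂ) (μ : Fin r → ℂ)
    (Γ Θ : Params r) (U V : Matrix (Fin n) (Fin r) ℂ) :
    star U.vec ⬝ᵥ (slopeQ A μ Γ Θ 0 *ᵥ V.vec) =
      ((∑ j : Fin (m + 1), powDiff (triC μ Γ) (triC μ Γ) (Uᴴ * A j * V) j) * triC 0 Θ).trace := by
  rw [slopeQ, Matrix.sum_mulVec, dotProduct_sum, Finset.sum_mul, Matrix.trace_sum]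
  refine Fintype.sum_congr _ _ fun j => ?_
  rw [Matrix.kronecker_mulVec_vec, Matrix.transpose_transpose, Matrix.star_vec_dotProduct_vec,
    zero_smul, add_zero, ← trace_mul_powDiff]
  simp only [Matrix.mul_assoc]

/-- Equality at a second index would make the multiplicity at least two. This supplies the gap
needed in `exists_singularValues_lt`. -/
theorem sv_lt_of_multiplicity (hn : 0 < n) (hr : 0 < r)
    {M : Matrix (Fin r × Fin n) (Fin r × Fin n) ℂ}
    (h : svMultiplicity M (svSmallest r M) = 1) (j : ℕ)
    (hj : j < Fintype.card (Fin r × Fin n) - r) : svSmallest r M < sv M j := by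
  have hcard : r ≤ Fintype.card (Fin r × Fin n) := by
    simpa using Nat.le_mul_of_pos_right r hn
  refine lt_of_le_of_ne (LinearMap.singularValues_antitone _ hj.le) fun he => ?_
  obtain ⟨a, ha⟩ := Set.ncard_eq_one.mp h
  have h1 : j ∈ ({a} : Set ℕ) := ha ▸ ⟨by omega, he.symm⟩
  have h2 : Fintype.card (Fin r × Fin n) - r ∈ ({a} : Set ℕ) := ha ▸ ⟨by omega, rfl⟩
  rw [Set.mem_singleton_iff] at h1 h2
  omega

/-- At a maximizer the derivative of a simple singular value vanishes. -/
theorem star_dotProduct_slopeQ_eq_zero (hn : 0 < n) (hr : 0 < r)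
    (A : Fin (m + 1) → Matrix (Fin n) (Fin n) ℂ) (μ : Fin r → ℂ) (Γ Θ : Params r)
    (hopt : IsOptimalParams A μ Γ) (hmul : MultiplicityAssumption A μ Γ)
    (hσ : 0 < objective A μ Γ) {U V : Matrix (Fin n) (Fin r) ℂ}
    (hV : ‖WithLp.toLp 2 V.vec‖ = 1)
    (hQV : blockQ A μ Γ *ᵥ V.vec = (objective A μ Γ : ℂ) • U.vec)
    (hUQ : star U.vec ᵥ* blockQ A μ Γ = (objective A μ Γ : ℂ) • star V.vec) :
    star U.vec ⬝ᵥ (slopeQ A μ Γ Θ 0 *ᵥ V.vec) = 0 := by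
  by_contra hz
  set z := star U.vec ⬝ᵥ (slopeQ A μ Γ Θ 0 *ᵥ V.vec) with hzdef
  set σ := objective A μ Γ with hσdef
  -- Rotating the direction by the conjugate of the complex derivative `z` turns it into `|z|² > 0`,
  -- so a real step suffices to exceed the maximum.
  have hcz : star U.vec ⬝ᵥ (slopeQ A μ Γ ((starRingEnd ℂ z) • Θ) 0 *ᵥ V.vec) =
      starRingEnd ℂ z * z := by
    rw [hzdef, slopeQ_mulVec_vec, slopeQ_mulVec_vec, triC_zero_smul, Matrix.mul_smul,
      Matrix.trace_smul, smul_eq_mul]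
  set Θ' := (starRingEnd ℂ z) • Θ with hΘ'
  set E := EuclideanSpace ℂ (Fin r × Fin n)
  set T : E →L[ℂ] E := Matrix.toEuclideanCLM (n := Fin r × Fin n) (𝕜 := ℂ) (blockQ A μ Γ) with hT
  set D : ℝ → E →L[ℂ] E := fun t => Matrix.toEuclideanCLM (n := Fin r × Fin n) (𝕜 := ℂ)
    (slopeQ A μ Γ Θ' (t : ℂ)) with hD
  have hcard : r ≤ Fintype.card (Fin r × Fin n) := by
    simpa using Nat.le_mul_of_pos_right r hn
  have hDc : Continuous D :=
    continuous_toEuclideanCLM.comp ((continuous_slopeQ A μ Γ Θ').comp Complex.continuous_ofReal)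
  have hTV : T (WithLp.toLp 2 V.vec) = (σ : ℂ) • WithLp.toLp 2 U.vec := by
    change WithLp.toLp 2 (blockQ A μ Γ *ᵥ V.vec) = _
    rw [hQV]
    rfl
  have hQU : (blockQ A μ Γ)ᴴ *ᵥ U.vec = (σ : ℂ) • V.vec := by
    have := congrArg star hUQ
    rw [Matrix.star_vecMul, star_star, star_smul, star_star] at this
    simpa using this
  obtain ⟨t, ht⟩ := LinearMap.exists_singularValues_lt T D hDc
    (k := Fintype.card (Fin r × Fin n) - r) (v := WithLp.toLp 2 V.vec)
    (by rw [finrank_euclideanSpace]; omega)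
    (by rw [← norm_ne_zero_iff, hV]; exact one_ne_zero)
    (by
      have hadj : LinearMap.adjoint (T : E →ₗ[ℂ] E) =
          Matrix.toEuclideanLin (blockQ A μ Γ)ᴴ :=
        (Matrix.toEuclideanLin_conjTranspose_eq_adjoint _).symm
      rw [hadj, hTV, map_smul]
      have h1 : Matrix.toEuclideanLin (blockQ A μ Γ)ᴴ (WithLp.toLp 2 U.vec) =
          (σ : ℂ) • WithLp.toLp 2 V.vec := by
        change WithLp.toLp 2 ((blockQ A μ Γ)ᴴ *ᵥ U.vec) = _
        rw [hQU]
        rfl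
      rw [h1, smul_smul]
      have h2 : (T : E →ₗ[ℂ] E).singularValues (Fintype.card (Fin r × Fin n) - r) = σ := rfl
      rw [h2]
      push_cast
      rw [sq]
      rfl)
    (fun j hj => sv_lt_of_multiplicity hn hr hmul j hj)
    (by
      rw [hTV, inner_smul_left]
      have h1 : inner ℂ (WithLp.toLp 2 U.vec : E) (D 0 (WithLp.toLp 2 V.vec)) =
          starRingEnd ℂ z * z := by
        rw [← hcz, dotProduct_comm, EuclideanSpace.inner_eq_star_dotProduct]
        simp only [hD, Complex.ofReal_zero]
        rfl
      rw [h1, Complex.conj_ofReal, Complex.conj_mul']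
      have h3 : (σ : ℂ) * (‖z‖ : ℂ) ^ 2 = ((σ * ‖z‖ ^ 2 : ℝ) : ℂ) := by push_cast; ring
      rw [h3]
      have : 0 < ‖z‖ := norm_pos_iff.mpr hz
      change 0 < σ * ‖z‖ ^ 2
      positivity)
  have h1 := hopt (Γ + (t : ℂ) • Θ')
  have h2 : Matrix.toEuclideanLin (blockQ A μ (Γ + (t : ℂ) • Θ')) =
      ((T + (t : ℂ) • D t : E →L[ℂ] E) : E →ₗ[ℂ] E) := by
    rw [← kronQ_eq_blockQ, kronQ_add_smul, kronQ_eq_blockQ, map_add, map_smul]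
    rfl
  rw [objective, svSmallest, sv, h2] at h1
  exact absurd h1 (not_le.mpr ht)

/-- At a maximizer with simple positive singular value, `U` and `V` have the same Gram matrix. -/
theorem gram_eq (hn : 0 < n) (hr : 0 < r)
    (A : Fin (m + 1) → Matrix (Fin n) (Fin n) ℂ) (μ : Fin r → ℂ) (Γ : Params r)
    (hopt : IsOptimalParams A μ Γ) (hmul : MultiplicityAssumption A μ Γ)
    (hσ : 0 < objective A μ Γ) {U V : Matrix (Fin n) (Fin r) ℂ}
    (hV : ‖WithLp.toLp 2 V.vec‖ = 1)
    (hQV : blockQ A μ Γ *ᵥ V.vec = (objective A μ Γ : ℂ) • U.vec)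
    (hUQ : star U.vec ᵥ* blockQ A μ Γ = (objective A μ Γ : ℂ) • star V.vec) :
    Uᴴ * U = Vᴴ * V := by
  set Y := triC μ Γ with hY
  set σ := objective A μ Γ with hσdef
  set B := ∑ j : Fin (m + 1), powDiff Y Y (Uᴴ * A j * V) j with hB
  -- The entry `B i l` is the derivative in the direction of `γ_{il}`; the free parameters
  -- correspond exactly to the entries below the diagonal.
  have hBlow : ∀ i l, l < i → B i l = 0 := by
    intro i l hl
    have h1 := star_dotProduct_slopeQ_eq_zero hn hr A μ Γ (Pi.single ⟨(i, l), hl⟩ 1) hopt hmul hσ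
      hV hQV hUQ
    rw [slopeQ_mulVec_vec, triC_zero_single, ← hY, ← hB, Matrix.trace_mul_single] at h1
    simpa using h1
  have hright : ∑ j : Fin (m + 1), A j * V * Y ^ (j : ℕ) = (σ : ℂ) • U := by
    rw [← kronQ_eq_blockQ, kronQ_mulVec_vec, ← Matrix.vec_smul] at hQV
    exact Matrix.vec_inj.mp hQV
  have hleft : ∑ j : Fin (m + 1), Y ^ (j : ℕ) * (Uᴴ * A j) = (σ : ℂ) • Vᴴ := by
    rw [← kronQ_eq_blockQ, kronQ, Matrix.star_vec, Matrix.star_vec, Matrix.vecMul_sum,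
      ← Matrix.vec_smul] at hUQ
    simp only [Matrix.vec_vecMul_kronecker] at hUQ
    rw [← Matrix.vec_sum] at hUQ
    have h1 := congrArg Matrix.transpose (Matrix.vec_inj.mp hUQ)
    rw [Matrix.transpose_sum, Matrix.transpose_smul] at h1
    simp only [Matrix.transpose_mul, Matrix.transpose_transpose] at h1
    exact h1
  -- After telescoping, the right singular equation evaluates the first sum and the left one the
  -- second.
  have hcomm : B * Y - Y * B = (σ : ℂ) • (Uᴴ * U - Vᴴ * V) := by
    have h1 : B * Y - Y * B = ∑ j : Fin (m + 1),
        (Uᴴ * A j * V * Y ^ (j : ℕ) - Y ^ (j : ℕ) * (Uᴴ * A j * V)) := by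
      rw [hB, Finset.sum_mul, Finset.mul_sum, ← Finset.sum_sub_distrib]
      exact Fintype.sum_congr _ _ fun j => powDiff_commutator _ _ _
    rw [h1, Finset.sum_sub_distrib, smul_sub, ← Matrix.mul_smul, ← hright, ← Matrix.smul_mul,
      ← hleft, Matrix.mul_sum, Matrix.sum_mul]
    simp only [Matrix.mul_assoc]
  have hherm : (B * Y - Y * B).IsHermitian := by
    rw [hcomm, Matrix.IsHermitian, Matrix.conjTranspose_smul, Matrix.conjTranspose_sub,
      Matrix.conjTranspose_mul, Matrix.conjTranspose_mul, Matrix.conjTranspose_conjTranspose,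
      Matrix.conjTranspose_conjTranspose]
    simp
  have h0 := Matrix.eq_zero_of_isHermitian_commutator hBlow
    (fun i l hl => triC_apply_of_lt μ Γ hl) hherm
  rw [hcomm, smul_eq_zero] at h0
  exact sub_eq_zero.mp (h0.resolve_left (by exact_mod_cast hσ.ne'))

/-! ### The optimal perturbation -/

theorem norm_sq_toLp (x : Fin n → ℂ) : ((‖WithLp.toLp 2 x‖ ^ 2 : ℝ) : ℂ) = star x ⬝ᵥ x := by
  rw [dotProduct_comm, ← EuclideanSpace.inner_toLp_toLp, inner_self_eq_norm_sq_to_K]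
  norm_cast

theorem norm_toLp_mulVec_eq_of_gram_eq {U V : Matrix (Fin n) (Fin r) ℂ} (h : Uᴴ * U = Vᴴ * V)
    (w : Fin r → ℂ) : ‖WithLp.toLp 2 (U *ᵥ w)‖ = ‖WithLp.toLp 2 (V *ᵥ w)‖ := by
  have key : ∀ W : Matrix (Fin n) (Fin r) ℂ, ((‖WithLp.toLp 2 (W *ᵥ w)‖ ^ 2 : ℝ) : ℂ) =
      star w ⬝ᵥ ((Wᴴ * W) *ᵥ w) := by
    intro W
    rw [norm_sq_toLp, Matrix.star_mulVec, ← Matrix.dotProduct_mulVec, Matrix.mulVec_mulVec]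
  have h1 : ‖WithLp.toLp 2 (U *ᵥ w)‖ ^ 2 = ‖WithLp.toLp 2 (V *ᵥ w)‖ ^ 2 := by
    have := (key U).trans ((congrArg (fun G => star w ⬝ᵥ (G *ᵥ w)) h).trans (key V).symm)
    exact_mod_cast this
  exact (sq_eq_sq₀ (norm_nonneg _) (norm_nonneg _)).mp h1

/-- The pseudoinverse `(V* V)⁻¹ V*`. -/
def leftInv (V : Matrix (Fin n) (Fin r) ℂ) : Matrix (Fin r) (Fin n) ℂ := (Vᴴ * V)⁻¹ * Vᴴ

open scoped ComplexOrder in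
theorem leftInv_mul {V : Matrix (Fin n) (Fin r) ℂ} (hV : V.rank = r) : leftInv V * V = 1 := by
  have hdet : (Vᴴ * V).det ≠ 0 := by
    apply Matrix.det_ne_zero_of_rank_eq
    rw [Matrix.rank_conjTranspose_mul_self, hV, Fintype.card_fin]
  rw [leftInv, Matrix.mul_assoc, Matrix.nonsing_inv_mul _ (isUnit_iff_ne_zero.mpr hdet)]

/-- `V * leftInv V` is the orthogonal projection onto the range of `V`. -/
theorem norm_mul_leftInv_le {V : Matrix (Fin n) (Fin r) ℂ} (hV : V.rank = r) (x : Fin n → ℂ) :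
    ‖WithLp.toLp 2 (V *ᵥ (leftInv V *ᵥ x))‖ ≤ ‖WithLp.toLp 2 x‖ := by
  set P := V * leftInv V with hP
  have hPP : P * P = P := by
    rw [hP, Matrix.mul_assoc, ← Matrix.mul_assoc (leftInv V), leftInv_mul hV, Matrix.one_mul]
  have hPH : Pᴴ = P := by
    have hs : ((Vᴴ * V)⁻¹)ᴴ = (Vᴴ * V)⁻¹ := by
      rw [Matrix.conjTranspose_nonsing_inv, Matrix.conjTranspose_mul,
        Matrix.conjTranspose_conjTranspose]
    rw [hP, leftInv, Matrix.conjTranspose_mul, Matrix.conjTranspose_mul, hs,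
      Matrix.conjTranspose_conjTranspose, Matrix.mul_assoc]
  rw [Matrix.mulVec_mulVec, ← hP]
  have h1 : ((‖WithLp.toLp 2 (P *ᵥ x)‖ ^ 2 : ℝ) : ℂ) =
      inner ℂ (WithLp.toLp 2 x) (WithLp.toLp 2 (P *ᵥ x)) := by
    rw [norm_sq_toLp, Matrix.star_mulVec, hPH, ← Matrix.dotProduct_mulVec, Matrix.mulVec_mulVec,
      hPP, EuclideanSpace.inner_toLp_toLp, dotProduct_comm]
  have h2 : ‖WithLp.toLp 2 (P *ᵥ x)‖ ^ 2 ≤ ‖WithLp.toLp 2 x‖ * ‖WithLp.toLp 2 (P *ᵥ x)‖ := by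
    have := norm_inner_le_norm (𝕜 := ℂ) (WithLp.toLp 2 x) (WithLp.toLp 2 (P *ᵥ x))
    rw [← h1, Complex.norm_real, Real.norm_of_nonneg (by positivity)] at this
    exact this
  rcases (norm_nonneg (WithLp.toLp 2 (P *ᵥ x))).eq_or_lt with h3 | h3
  · rw [← h3]
    exact norm_nonneg _
  · exact le_of_mul_le_mul_right (by rwa [← sq]) h3

/-- Equal Gram matrices make `V w ↦ U w` an isometry, so `U * leftInv V` is that isometry after an
orthogonal projection. -/
theorem specNorm_smul_mul_leftInv_le {σ : ℝ} (hσ : 0 ≤ σ) {U V : Matrix (Fin n) (Fin r) ℂ}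
    (hV : V.rank = r) (h : 0 < σ → Uᴴ * U = Vᴴ * V) :
    specNorm (-((σ : ℂ) • (U * leftInv V))) ≤ σ := by
  refine ContinuousLinearMap.opNorm_le_bound _ hσ fun x => ?_
  obtain ⟨x, rfl⟩ := (WithLp.equiv 2 (Fin n → ℂ)).symm.surjective x
  change ‖WithLp.toLp 2 (-((σ : ℂ) • (U * leftInv V)) *ᵥ x)‖ ≤ σ * ‖WithLp.toLp 2 x‖
  rw [Matrix.neg_mulVec, Matrix.smul_mulVec, WithLp.toLp_neg, norm_neg, WithLp.toLp_smul,
    norm_smul, Complex.norm_real, Real.norm_of_nonneg hσ]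
  rcases hσ.eq_or_lt with h0 | h0
  · simp [← h0]
  · gcongr
    rw [← Matrix.mulVec_mulVec, norm_toLp_mulVec_eq_of_gram_eq (h h0)]
    exact norm_mul_leftInv_le hV x

/-- The factor split off from `M` acts as `Z` on the range of `V` and as the identity on the kernel
of `L`; Sylvester's identity gives its determinant. -/
theorem det_dvd_det_of_mul_eq (M : Matrix (Fin n) (Fin n) ℂ[X]) (N V : Matrix (Fin n) (Fin r) ℂ[X])
    (L : Matrix (Fin r) (Fin n) ℂ[X]) (Z : Matrix (Fin r) (Fin r) ℂ[X]) (hL : L * V = 1)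
    (h : M * V = N * Z) : Z.det ∣ M.det := by
  have hM : M = (M - M * V * L + N * L) * (1 + V * ((Z - 1) * L)) := by
    have e1 : M * V * L * (V * ((Z - 1) * L)) = M * V * ((Z - 1) * L) := by
      rw [Matrix.mul_assoc (M * V), ← Matrix.mul_assoc L, hL, Matrix.one_mul]
    have e2 : N * L * (V * ((Z - 1) * L)) = N * ((Z - 1) * L) := by
      rw [Matrix.mul_assoc N, ← Matrix.mul_assoc L, hL, Matrix.one_mul]
    rw [Matrix.mul_add, Matrix.mul_one, Matrix.add_mul, Matrix.sub_mul, e1, e2,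
      ← Matrix.mul_assoc M V, sub_self, zero_add, Matrix.sub_mul, Matrix.one_mul, Matrix.mul_sub,
      ← Matrix.mul_assoc N Z, ← h]
    abel
  have hdet : (1 + V * ((Z - 1) * L)).det = Z.det := by
    rw [Matrix.det_one_add_mul_comm, Matrix.mul_assoc, hL, Matrix.mul_one, add_sub_cancel]
  rw [hM, Matrix.det_mul, hdet]
  exact dvd_mul_left _ _

/-- An invariant pair `(V, Y)` with `V` of full rank: the characteristic polynomial of `Y` divides
`det (P + Δ)`. -/
theorem charpoly_dvd_pertDet (A : Fin (m + 1) → Matrix (Fin n) (Fin n) ℂ)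
    (Δ : Matrix (Fin n) (Fin n) ℂ) {V : Matrix (Fin n) (Fin r) ℂ} {L : Matrix (Fin r) (Fin n) ℂ}
    (hL : L * V = 1) (Y : Matrix (Fin r) (Fin r) ℂ)
    (h : (∑ j : Fin (m + 1), A j * V * Y ^ (j : ℕ)) + Δ * V = 0) : Y.charpoly ∣ pertDet A Δ := by
  set x : Matrix (Fin r) (Fin r) ℂ[X] := Matrix.scalar (Fin r) X with hx
  set y : Matrix (Fin r) (Fin r) ℂ[X] := Y.map C with hy
  have hxy : Commute x y := Matrix.scalar_commute _ (fun _ => Commute.all _ _) _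
  have hmapC : ∀ j : ℕ, (Y ^ j).map C = y ^ j := fun j => by
    rw [hy]
    exact map_pow (C : ℂ →+* ℂ[X]).mapMatrix Y j
  have hz : (∑ j : Fin (m + 1), (A j).map C * V.map C * y ^ (j : ℕ)) + Δ.map C * V.map C = 0 := by
    have h1 := congrArg (fun M : Matrix (Fin n) (Fin r) ℂ => M.map (C : ℂ →+* ℂ[X])) h
    rw [Matrix.map_add _ (fun a b => map_add C a b), Matrix.map_mul,
      Matrix.map_zero _ (map_zero C)] at h1
    rw [← h1]
    congr 1
    ext a b : 2
    simp only [Matrix.map_apply, Matrix.sum_apply, map_sum, ← hmapC, ← Matrix.map_mul]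
  -- Subtracting the relation `hz` from `(P + Δ) V` leaves `∑ Aⱼ V (xʲ - yʲ)`, and each difference
  -- of powers is a geometric sum times `x - y`, the characteristic matrix.
  refine det_dvd_det_of_mul_eq (pertMat A Δ)
    (∑ j : Fin (m + 1), (A j).map C * V.map C *
      ∑ i ∈ Finset.range j, x ^ i * y ^ ((j : ℕ) - 1 - i)) (V.map C) (L.map C) Y.charmatrix ?_ ?_
  · rw [← Matrix.map_mul, hL, Matrix.map_one _ (map_zero C) (map_one C)]
  · have hch : Y.charmatrix = x - y := rfl
    have hterm : ∀ j : ℕ, ∀ B : Matrix (Fin n) (Fin n) ℂ,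
        (X : ℂ[X]) ^ j • B.map C * V.map C = B.map C * V.map C * x ^ j := by
      intro j B
      rw [hx, ← map_pow, Matrix.smul_mul]
      ext a b : 2
      simp [mul_comm]
    rw [hch, Matrix.sum_mul]
    simp only [Matrix.mul_assoc _ (∑ i ∈ _, _), hxy.geom_sum₂_mul, Matrix.mul_sub,
      Finset.sum_sub_distrib]
    rw [pertMat, Matrix.add_mul, Matrix.sum_mul, Finset.sum_congr rfl fun (j : Fin (m + 1)) _ => hterm (j : ℕ) (A j),
      eq_sub_iff_add_eq, add_assoc, add_comm (Δ.map C * V.map C), hz, add_zero]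

theorem isUpperTriangular_triC (μ : Fin r → ℂ) (Γ : Params r) : (triC μ Γ).IsUpperTriangular :=
  fun _ _ h => triC_apply_of_lt μ Γ h

theorem charpoly_triC (μ : Fin r → ℂ) (Γ : Params r) :
    (triC μ Γ).charpoly = ∏ i, (X - C (μ i)) := by
  rw [Matrix.charpoly_of_isUpperTriangular _ (isUpperTriangular_triC μ Γ)]
  simp only [triC_apply_self]

/-- If the determinant vanished identically, so would `det (yᵐ (P(1/y) + Δ))` for `y ≠ 0`, hence by
continuity at `y = 0`. There only `Aₘ` survives, as `m > 0` removes `Δ`. -/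
theorem pertDet_ne_zero (hm : 0 < m) (A : Fin (m + 1) → Matrix (Fin n) (Fin n) ℂ)
    (hA : (A (Fin.last m)).rank = n) (Δ : Matrix (Fin n) (Fin n) ℂ) : pertDet A Δ ≠ 0 := by
  intro h0
  have heval : ∀ z : ℂ, ((∑ j : Fin (m + 1), z ^ (j : ℕ) • A j) + Δ).det = 0 := by
    intro z
    have h1 := congrArg (eval z) h0
    rw [eval_zero, pertDet, ← coe_evalRingHom, RingHom.map_det] at h1
    rw [← h1]
    congr 1
    ext a b
    simp [Matrix.sum_apply, eval_finsetSum]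
    exact Fintype.sum_congr _ _ fun j => mul_comm _ _
  let f : ℂ → ℂ := fun y => ((∑ j : Fin (m + 1), y ^ (m - (j : ℕ)) • A j) + y ^ m • Δ).det
  have hf : Continuous f := by
    refine Continuous.matrix_det ?_
    fun_prop
  have hf0 : ∀ y ∈ ({0}ᶜ : Set ℂ), f y = 0 := by
    intro y hy
    have e : (∑ j : Fin (m + 1), y ^ (m - (j : ℕ)) • A j) + y ^ m • Δ =
        y ^ m • ((∑ j : Fin (m + 1), y⁻¹ ^ (j : ℕ) • A j) + Δ) := by
      rw [smul_add, Finset.smul_sum]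
      congr 1
      refine Fintype.sum_congr _ _ fun j => ?_
      rw [smul_smul, inv_pow, pow_sub₀ y hy (Nat.lt_succ_iff.mp j.2)]
    change ((∑ j : Fin (m + 1), y ^ (m - (j : ℕ)) • A j) + y ^ m • Δ).det = 0
    rw [e, Matrix.det_smul, heval, mul_zero]
  have hzero : f 0 = 0 := by
    have : f = fun _ => 0 :=
      Continuous.ext_on (dense_compl_singleton (0 : ℂ)) hf continuous_const hf0
    rw [this]
  have hlast : f 0 = (A (Fin.last m)).det := by
    change ((∑ j : Fin (m + 1), (0 : ℂ) ^ (m - (j : ℕ)) • A j) + (0 : ℂ) ^ m • Δ).det = _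
    rw [zero_pow hm.ne', zero_smul, add_zero, Finset.sum_eq_single (Fin.last m)]
    · simp
    · intro j _ hj
      rw [zero_pow (by have := Fin.val_lt_last hj; omega), zero_smul]
    · simp
  exact Matrix.det_ne_zero_of_rank_eq (by rw [hA, Fintype.card_fin]) (hlast.symm.trans hzero)

/-! ### Multiplicities -/

theorem le_sum_rootMultiplicity {p : ℂ[X]} (hp : p ≠ 0) {S : Finset ℂ} {μ : Fin r → ℂ}
    (hμ : μ ∈ tuples S r) (h : ∏ i, (X - C (μ i)) ∣ p) :
    r ≤ ∑ z ∈ S, p.rootMultiplicity z := by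
  set s : Multiset ℂ := Finset.univ.val.map μ with hs
  have hle : s ≤ p.roots := by
    rw [← Multiset.prod_X_sub_C_dvd_iff_le_roots hp, hs, Multiset.map_map]
    exact h
  have hcard : ∑ z ∈ S, s.count z = r := by
    rw [Multiset.sum_count_eq_card, hs]
    · simp
    · intro a ha
      rw [hs, Multiset.mem_map] at ha
      obtain ⟨i, _, rfl⟩ := ha
      exact hμ i
  rw [← hcard]
  refine Finset.sum_le_sum fun z _ => ?_
  rw [← count_roots]
  exact Multiset.count_le_of_le z hle

theorem exists_tuple_of_le_sum_rootMultiplicity {p : ℂ[X]} (hp : p ≠ 0) {S : Finset ℂ}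
    (h : r ≤ ∑ z ∈ S, p.rootMultiplicity z) :
    ∃ ν ∈ tuples S r, ∏ i, (X - C (ν i)) ∣ p := by
  classical
  set s := p.roots.filter (· ∈ S) with hs
  have hcard : r ≤ Multiset.card s := by
    rw [← Multiset.sum_count_eq_card (s := S) fun a ha => (Multiset.mem_filter.mp ha).2]
    refine h.trans_eq (Finset.sum_congr rfl fun z hz => ?_)
    rw [Multiset.count_filter_of_pos hz, count_roots]
  obtain ⟨t, ht⟩ : ∃ t, t ∈ s.powersetCard r := by
    rw [← Multiset.card_pos_iff_exists_mem, Multiset.card_powersetCard]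
    exact Nat.choose_pos hcard
  rw [Multiset.mem_powersetCard] at ht
  obtain ⟨hts, htc⟩ := ht
  induction t using Quotient.inductionOn with
  | h l =>
    change (l : Multiset ℂ) ≤ s at hts
    change l.length = r at htc
    subst htc
    refine ⟨fun i => l[i.1], fun i => ?_, ?_⟩
    · exact (Multiset.mem_filter.mp (Multiset.mem_of_le hts (List.getElem_mem i.2))).2
    · change ∏ i : Fin l.length, (X - C l[i.1]) ∣ p
      rw [Fin.prod_univ_fun_getElem l fun a => X - C a]
      exact (Multiset.prod_X_sub_C_dvd_iff_le_roots hp l).mpr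
        (hts.trans (Multiset.filter_le _ _))

/-! ### The two bounds for `τᵣ` -/

theorem iInf_innerSup_le_tau (hm : 0 < m) (hn : 0 < n) (hr : 0 < r)
    (A : Fin (m + 1) → Matrix (Fin n) (Fin n) ℂ) (hA : (A (Fin.last m)).rank = n)
    (S : Finset ℂ) : ⨅ ν ∈ tuples S r, innerSup A ν ≤ tau A S r := by
  refine le_iInf₂ fun Δ hΔ => ?_
  obtain ⟨ν, hν, hdvd⟩ := exists_tuple_of_le_sum_rootMultiplicity (pertDet_ne_zero hm A hA Δ) hΔ
  refine (iInf₂_le ν hν).trans (iSup_le fun Γ => ENNReal.ofReal_le_ofReal ?_)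
  exact svSmallest_blockQ_le_specNorm hn hr A Δ ν Γ hdvd

theorem objective_nonneg (A : Fin (m + 1) → Matrix (Fin n) (Fin n) ℂ) (μ : Fin r → ℂ)
    (Γ : Params r) : 0 ≤ objective A μ Γ :=
  LinearMap.singularValues_nonneg _ _

theorem tau_le_objective (hm : 0 < m) (hn : 0 < n) (hr : 0 < r)
    (A : Fin (m + 1) → Matrix (Fin n) (Fin n) ℂ) (hA : (A (Fin.last m)).rank = n)
    (S : Finset ℂ) {μ : Fin r → ℂ} (hμ : μ ∈ tuples S r) {Γ : Params r}
    (hopt : IsOptimalParams A μ Γ) (hmul : MultiplicityAssumption A μ Γ)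
    (hlin : LinearIndependenceAssumption A μ Γ) :
    tau A S r ≤ ENNReal.ofReal (objective A μ Γ) := by
  obtain ⟨U, V, -, hV, hQV, hUQ, hrank⟩ := hlin
  set σ := objective A μ Γ with hσ
  set Δ := -((σ : ℂ) • (U * leftInv V)) with hΔ
  have hnorm : specNorm Δ ≤ σ := specNorm_smul_mul_leftInv_le (objective_nonneg A μ Γ) hrank
    fun h0 => gram_eq hn hr A μ Γ hopt hmul h0 hV hQV hUQ
  have hinv : (∑ j : Fin (m + 1), A j * V * triC μ Γ ^ (j : ℕ)) + Δ * V = 0 := by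
    rw [← kronQ_eq_blockQ, kronQ_mulVec_vec, ← Matrix.vec_smul] at hQV
    rw [Matrix.vec_inj.mp hQV, hΔ, Matrix.neg_mul, Matrix.smul_mul, Matrix.mul_assoc,
      leftInv_mul hrank, Matrix.mul_one, add_neg_cancel]
  have hdvd := charpoly_dvd_pertDet A Δ (leftInv_mul hrank) (triC μ Γ) hinv
  rw [charpoly_triC] at hdvd
  exact (iInf₂_le Δ (le_sum_rootMultiplicity (pertDet_ne_zero hm A hA Δ) hμ hdvd)).trans
    (ENNReal.ofReal_le_ofReal hnorm)

/-! ### Attainment of the inner supremum -/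

theorem continuous_objective (A : Fin (m + 1) → Matrix (Fin n) (Fin n) ℂ) (μ : Fin r → ℂ) :
    Continuous (objective A μ) := by
  have hT : Continuous fun Γ : Params r =>
      Matrix.toEuclideanCLM (n := Fin r × Fin n) (𝕜 := ℂ) (blockQ A μ Γ) := by
    simp only [← kronQ_eq_blockQ]
    exact continuous_toEuclideanCLM.comp (continuous_kronQ A μ)
  have key : ∀ Γ Γ' : Params r, objective A μ Γ ≤ objective A μ Γ' +
      ‖Matrix.toEuclideanCLM (n := Fin r × Fin n) (𝕜 := ℂ) (blockQ A μ Γ) -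
        Matrix.toEuclideanCLM (n := Fin r × Fin n) (𝕜 := ℂ) (blockQ A μ Γ')‖ := fun Γ Γ' =>
    LinearMap.singularValues_le_add _ _ _ (norm_nonneg _) fun x =>
      (Matrix.toEuclideanCLM (n := Fin r × Fin n) (𝕜 := ℂ) (blockQ A μ Γ) -
        Matrix.toEuclideanCLM (n := Fin r × Fin n) (𝕜 := ℂ) (blockQ A μ Γ')).le_opNorm x
  refine continuous_iff_continuousAt.mpr fun Γ₀ => ?_
  refine tendsto_iff_dist_tendsto_zero.mpr ?_
  refine squeeze_zero (fun _ => dist_nonneg) (fun Γ => ?_)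
    (tendsto_iff_dist_tendsto_zero.mp (hT.tendsto Γ₀))
  rw [Real.dist_eq, dist_eq_norm, abs_le]
  have h1 := key Γ Γ₀
  have h2 := key Γ₀ Γ
  rw [norm_sub_rev] at h2
  constructor <;> linarith

/-- `Γ` with the entries `γ_{il}`, `i - l ≥ d`, replaced by `0`. -/
def truncate (Γ : Params r) (d : ℕ) : Params r := fun p =>
  if (p.1.1 : ℕ) - (p.1.2 : ℕ) < d then Γ p else 0

theorem gam_truncate_of_lt (Γ : Params r) {d : ℕ} {i l : Fin r} (h : (i : ℕ) - (l : ℕ) < d) :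
    gam (truncate Γ d) i l = gam Γ i l := by
  simp only [gam, truncate, if_pos h]

theorem gam_truncate_of_le (Γ : Params r) {d : ℕ} {i l : Fin r} (h : d ≤ (i : ℕ) - (l : ℕ)) :
    gam (truncate Γ d) i l = 0 := by
  simp only [gam, truncate, if_neg (not_lt.mpr h), dite_eq_ite, ite_self]

theorem prod_gam_truncate (Γ : Params r) {d k : ℕ} {s : Fin (k + 1) → Fin r}
    (h : ∀ t : Fin k, (s t.succ : ℕ) - (s t.castSucc : ℕ) < d) :
    ∏ t : Fin k, gam (truncate Γ d) (s t.succ) (s t.castSucc) =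
      ∏ t : Fin k, gam Γ (s t.succ) (s t.castSucc) :=
  Fintype.prod_congr _ _ fun t => gam_truncate_of_lt Γ (h t)

/-- Only the one-link chain from `l` to `i` uses `γ_{il}` itself; links of longer chains span less
than the whole distance. -/
theorem sub_lt_of_strictMono {k : ℕ} {s : Fin (k + 1) → Fin r} (hs : StrictMono s) (hk : k ≠ 1)
    (t : Fin k) :
    (s t.succ : ℕ) - (s t.castSucc : ℕ) < (s (Fin.last k) : ℕ) - (s 0 : ℕ) := by
  have h1 : s 0 ≤ s t.castSucc := hs.monotone (Fin.zero_le _)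
  have h2 : s t.succ ≤ s (Fin.last k) := hs.monotone (Fin.le_last _)
  have h3 : s t.castSucc < s t.succ := hs Fin.castSucc_lt_succ
  rcases Nat.eq_zero_or_pos (t : ℕ) with h0 | h0
  · have h4 : s t.succ < s (Fin.last k) := hs (by
      rw [Fin.lt_def]
      have := t.2
      simp only [Fin.val_succ, Fin.val_last]
      omega)
    simp only [Fin.lt_def, Fin.le_def] at *
    omega
  · have h4 : s 0 < s t.castSucc := hs (by
      rw [Fin.lt_def]
      simpa using h0)
    simp only [Fin.lt_def, Fin.le_def] at *
    omega

theorem chainPart_truncate (μ : Fin r → ℂ) (Γ : Params r) (p : ℂ[X]) {d k : ℕ} {l i : Fin r}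
    (h : (i : ℕ) - (l : ℕ) < d ∨ ((i : ℕ) - (l : ℕ) ≤ d ∧ k ≠ 1)) :
    chainPart μ (truncate Γ d) p k l i = chainPart μ Γ p k l i := by
  refine Fintype.sum_congr _ _ fun s => ?_
  split_ifs with hs
  · congr 1
    by_cases hmono : StrictMono s
    · refine prod_gam_truncate Γ fun t => ?_
      by_cases hk : k = 1
      · subst hk
        rw [Subsingleton.elim t 0]
        have h1 : s (Fin.succ 0) = i := hs.2
        have h2 : s (Fin.castSucc 0) = l := hs.1
        rw [h1, h2]
        rcases h with h | h
        · exact h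
        · exact absurd rfl h.2
      · have := sub_lt_of_strictMono hmono hk t
        rw [hs.1, hs.2] at this
        omega
    · have hz : ∀ Γ' : Params r, ∏ t : Fin k, gam Γ' (s t.succ) (s t.castSucc) = 0 := by
        intro Γ'
        by_contra hne
        exact hmono (strictMono_of_prod_gam_ne_zero Γ' hne)
      rw [hz, hz]
  · rfl

theorem chainPart_one (μ : Fin r → ℂ) (Γ : Params r) (p : ℂ[X]) (l i : Fin r) :
    chainPart μ Γ p 1 l i = gam Γ i l * p.divDiff ![μ l, μ i] := by
  rw [chainPart, Fintype.sum_eq_single ![l, i]]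
  · rw [if_pos ⟨rfl, rfl⟩]
    simp only [Finset.univ_unique, Finset.prod_singleton]
    congr 2
    ext t
    fin_cases t <;> rfl
  · intro s hs
    refine if_neg fun h => hs ?_
    ext t
    fin_cases t
    · exact congrArg Fin.val h.1
    · exact congrArg Fin.val h.2

theorem blockQ_truncate_of_lt (A : Fin (m + 1) → Matrix (Fin n) (Fin n) ℂ) (μ : Fin r → ℂ)
    (Γ : Params r) {d : ℕ} {i l : Fin r} (h : (i : ℕ) - (l : ℕ) < d) (a b : Fin n) :
    blockQ A μ Γ (i, a) (l, b) = blockQ A μ (truncate Γ d) (i, a) (l, b) := by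
  rw [blockQ_apply, blockQ_apply]
  exact Finset.sum_congr rfl fun k _ => (chainPart_truncate μ Γ _ (Or.inl h)).symm

/-- Isolates the contribution of `γ_{il}`; everything else in the block depends only on parameters
with smaller index distance, which makes induction on that distance possible. -/
theorem blockQ_truncate_of_eq (A : Fin (m + 1) → Matrix (Fin n) (Fin n) ℂ) (μ : Fin r → ℂ)
    (Γ : Params r) {i l : Fin r} (h : l < i) (a b : Fin n) :
    blockQ A μ Γ (i, a) (l, b) = gam Γ i l * matDividedDiff A ![μ l, μ i] a b +
      blockQ A μ (truncate Γ ((i : ℕ) - (l : ℕ))) (i, a) (l, b) := by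
  have h1 : 1 ∈ Finset.range r := by
    have : (l : ℕ) < i := h
    have := i.2
    rw [Finset.mem_range]
    omega
  rw [blockQ_apply, blockQ_apply, matDividedDiff_apply, chainTotal, chainTotal,
    ← Finset.add_sum_erase _ _ h1, ← Finset.add_sum_erase _ _ h1, chainPart_one, chainPart_one,
    gam_truncate_of_le Γ le_rfl, zero_mul, zero_add]
  congr 1
  refine Finset.sum_congr rfl fun k hk => ?_
  exact (chainPart_truncate μ Γ _ (Or.inr ⟨le_rfl, Finset.ne_of_mem_erase hk⟩)).symm

/-- The blocks of `x` before `l` together with the blocks of `M x` after `l`. -/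
def blockMap (M : Matrix (Fin r × Fin n) (Fin r × Fin n) ℂ) (l : Fin r) :
    (Fin r × Fin n → ℂ) →ₗ[ℂ] ({i : Fin r // i ≠ l} × Fin n → ℂ) :=
  LinearMap.pi fun p => if p.1.1 < l then LinearMap.proj (p.1.1, p.2) else
    LinearMap.proj (p.1.1, p.2) ∘ₗ M.mulVecLin

/-- Vectors that vanish in the blocks before `l` and whose image vanishes in the blocks after
`l`. -/
def blockSpace (M : Matrix (Fin r × Fin n) (Fin r × Fin n) ℂ) (l : Fin r) :
    Submodule ℂ (Fin r × Fin n → ℂ) :=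
  LinearMap.ker (blockMap M l)

/-- There are `r n` unknowns and `(r - 1) n` linear conditions, one block for each index other than
`l`. -/
theorem le_finrank_blockSpace (M : Matrix (Fin r × Fin n) (Fin r × Fin n) ℂ) (l : Fin r) :
    n ≤ finrank ℂ (blockSpace M l) := by
  have h1 := (blockMap M l).finrank_range_add_finrank_ker
  have h2 := Submodule.finrank_le (LinearMap.range (blockMap M l))
  have hcard : Fintype.card {i : Fin r // i ≠ l} = r - 1 := by
    simp [Fintype.card_subtype_compl]
  rw [finrank_fintype_fun_eq_card, Fintype.card_prod, Fintype.card_fin] at h1 h2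
  rw [Fintype.card_fin] at h1
  rw [hcard] at h2
  have h3 : r * n = (r - 1) * n + n := by
    obtain ⟨q, rfl⟩ : ∃ q, r = q + 1 := ⟨r - 1, by have := l.2; omega⟩
    simp only [Nat.add_sub_cancel]
    ring
  change n ≤ finrank ℂ (LinearMap.ker (blockMap M l))
  omega

theorem mem_blockSpace_left {M : Matrix (Fin r × Fin n) (Fin r × Fin n) ℂ} {l : Fin r}
    {x : Fin r × Fin n → ℂ} (hx : x ∈ blockSpace M l) {q : Fin r} (hq : q < l) (a : Fin n) :
    x (q, a) = 0 := by
  have := congrFun (LinearMap.mem_ker.mp hx) (⟨q, hq.ne⟩, a)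
  simpa [blockMap, hq] using this

theorem mem_blockSpace_right {M : Matrix (Fin r × Fin n) (Fin r × Fin n) ℂ} {l : Fin r}
    {x : Fin r × Fin n → ℂ} (hx : x ∈ blockSpace M l) {q : Fin r} (hq : l < q) (a : Fin n) :
    (M *ᵥ x) (q, a) = 0 := by
  have := congrFun (LinearMap.mem_ker.mp hx) (⟨q, hq.ne'⟩, a)
  simpa [blockMap, hq.not_gt] using this

/-- The block `l` of a vector. -/
def block (x : Fin r × Fin n → ℂ) (l : Fin r) : Fin n → ℂ := fun a => x (l, a)

theorem norm_sq_toLp_eq_sum_block (x : Fin r × Fin n → ℂ) :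
    ‖WithLp.toLp 2 x‖ ^ 2 = ∑ l, ‖WithLp.toLp 2 (block x l)‖ ^ 2 := by
  simp only [EuclideanSpace.norm_sq_eq, Fintype.sum_prod_type]
  rfl

theorem norm_toLp_block_le (x : Fin r × Fin n → ℂ) (l : Fin r) :
    ‖WithLp.toLp 2 (block x l)‖ ≤ ‖WithLp.toLp 2 x‖ := by
  refine le_of_sq_le_sq ?_ (norm_nonneg _)
  rw [norm_sq_toLp_eq_sum_block]
  exact Finset.single_le_sum (f := fun l => ‖WithLp.toLp 2 (block x l)‖ ^ 2)
    (fun _ _ => by positivity) (Finset.mem_univ l)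

theorem blockQ_eq_zero_of_lt (A : Fin (m + 1) → Matrix (Fin n) (Fin n) ℂ) (μ : Fin r → ℂ)
    (Γ : Params r) {i l : Fin r} (h : i < l) (a b : Fin n) : blockQ A μ Γ (i, a) (l, b) = 0 := by
  simp [blockQ, h.not_gt, h.ne]

theorem block_blockQ_mulVec_self (A : Fin (m + 1) → Matrix (Fin n) (Fin n) ℂ) (μ : Fin r → ℂ)
    (Γ : Params r) {l : Fin r} {x : Fin r × Fin n → ℂ} (hx : ∀ q < l, ∀ a, x (q, a) = 0) :
    block (blockQ A μ Γ *ᵥ x) l = value A (μ l) *ᵥ block x l := by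
  ext a
  simp only [block, Matrix.mulVec, dotProduct, Fintype.sum_prod_type]
  rw [Finset.sum_eq_single l]
  · refine Fintype.sum_congr _ _ fun b => ?_
    simp [blockQ]
  · intro q _ hq
    refine Finset.sum_eq_zero fun b _ => ?_
    rcases lt_or_gt_of_ne hq with h | h
    · rw [hx q h, mul_zero]
    · rw [blockQ_eq_zero_of_lt A μ Γ h, zero_mul]
  · simp

theorem block_blockQ_mulVec_truncate (A : Fin (m + 1) → Matrix (Fin n) (Fin n) ℂ) (μ : Fin r → ℂ)
    (Γ : Params r) {i l : Fin r} (h : l < i) {x : Fin r × Fin n → ℂ}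
    (hx : ∀ q < l, ∀ a, x (q, a) = 0) :
    block (blockQ A μ Γ *ᵥ x) i = gam Γ i l • (matDividedDiff A ![μ l, μ i] *ᵥ block x l) +
      block (blockQ A μ (truncate Γ ((i : ℕ) - (l : ℕ))) *ᵥ x) i := by
  ext a
  simp only [block, Matrix.mulVec, dotProduct, Fintype.sum_prod_type, Pi.add_apply, Pi.smul_apply,
    smul_eq_mul]
  have hterm : ∀ q, ∑ b, blockQ A μ Γ (i, a) (q, b) * x (q, b) =
      (if q = l then gam Γ i l * ∑ b, matDividedDiff A ![μ l, μ i] a b * x (l, b) else 0) +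
        ∑ b, blockQ A μ (truncate Γ ((i : ℕ) - (l : ℕ))) (i, a) (q, b) * x (q, b) := by
    intro q
    split_ifs with hq
    · subst hq
      rw [Finset.mul_sum, ← Finset.sum_add_distrib]
      refine Fintype.sum_congr _ _ fun b => ?_
      rw [blockQ_truncate_of_eq A μ Γ h, add_mul, mul_assoc]
    · rw [zero_add]
      refine Fintype.sum_congr _ _ fun b => ?_
      rcases lt_or_gt_of_ne hq with h1 | h1
      · rw [hx q h1, mul_zero, mul_zero]
      · rw [blockQ_truncate_of_lt A μ Γ (d := (i : ℕ) - (l : ℕ))]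
        have h2 : (l : ℕ) < q := h1
        have h3 : (l : ℕ) < i := h
        omega
  rw [Finset.sum_congr rfl fun q _ => hterm q, Finset.sum_add_distrib, Finset.sum_ite_eq',
    if_pos (Finset.mem_univ l)]

/-- If the truncations of `Γ` are bounded, then `σ₋ᵣ(Q) |γ_{il}|` is bounded. -/
theorem objective_mul_gam_le (hn : 0 < n) (hr : 0 < r) (hrn : r ≤ n)
    (A : Fin (m + 1) → Matrix (Fin n) (Fin n) ℂ) (μ : Fin r → ℂ) (Γ : Params r) {i l : Fin r}
    (h : l < i) (hG : (matDividedDiff A ![μ l, μ i]).det ≠ 0) (hγ : gam Γ i l ≠ 0) {K : ℝ}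
    (hK : ‖Matrix.toEuclideanCLM (n := Fin r × Fin n) (𝕜 := ℂ)
      (blockQ A μ (truncate Γ ((i : ℕ) - (l : ℕ))))‖ ≤ K) :
    objective A μ Γ * ‖gam Γ i l‖ ≤
      specNorm (value A (μ l)) * specNorm (matDividedDiff A ![μ l, μ i])⁻¹ * K := by
  set G := matDividedDiff A ![μ l, μ i] with hGdef
  set γ := gam Γ i l with hγdef
  have hγ0 : 0 < ‖γ‖ := norm_pos_iff.mpr hγ
  rw [← le_div_iff₀ hγ0]
  -- This test space has dimension at least `n ≥ r`. On it `Q x` lives in block `l` alone, where it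
  -- equals `P(μₗ) xₗ`, and a large `γ_{il}` forces `xₗ` to be small.
  refine svSmallest_le hr ?_ (blockSpace (blockQ A μ Γ) l)
    (hrn.trans (le_finrank_blockSpace _ l)) fun x hx => ?_
  · simpa using Nat.le_mul_of_pos_right r hn
  have hx0 : ∀ q < l, ∀ a, x (q, a) = 0 := fun q hq a => mem_blockSpace_left hx hq a
  have hnorm : ‖WithLp.toLp 2 (blockQ A μ Γ *ᵥ x)‖ =
      ‖WithLp.toLp 2 (value A (μ l) *ᵥ block x l)‖ := by
    rw [← sq_eq_sq₀ (norm_nonneg _) (norm_nonneg _), norm_sq_toLp_eq_sum_block,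
      Finset.sum_eq_single l, block_blockQ_mulVec_self A μ Γ hx0]
    · intro q _ hq
      have : block (blockQ A μ Γ *ᵥ x) q = 0 := by
        ext a
        rcases lt_or_gt_of_ne hq with h1 | h1
        · simp only [block, Matrix.mulVec, dotProduct, Pi.zero_apply]
          refine Finset.sum_eq_zero fun p _ => ?_
          rcases lt_or_ge p.1 l with h2 | h2
          · rw [show x p = 0 from hx0 p.1 h2 p.2, mul_zero]
          · rw [show blockQ A μ Γ (q, a) p = 0 from
              blockQ_eq_zero_of_lt A μ Γ (h1.trans_le h2) a p.2, zero_mul]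
        · exact mem_blockSpace_right hx h1 a
      simp [this]
    · simp
  -- Block `i` of `Q x` vanishes, so the `γ_{il}` term balances the truncated part; inverting `G`
  -- then bounds `xₗ`.
  have hrow : γ • (G *ᵥ block x l) =
      -block (blockQ A μ (truncate Γ ((i : ℕ) - (l : ℕ))) *ᵥ x) i := by
    have h1 := block_blockQ_mulVec_truncate A μ Γ h hx0
    have h2 : block (blockQ A μ Γ *ᵥ x) i = 0 := by
      ext a
      exact mem_blockSpace_right hx h a
    rw [h2] at h1
    exact eq_neg_of_add_eq_zero_left h1.symm
  have hxl : γ • block x l =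
      -(G⁻¹ *ᵥ block (blockQ A μ (truncate Γ ((i : ℕ) - (l : ℕ))) *ᵥ x) i) := by
    rw [← Matrix.mulVec_neg, ← hrow, Matrix.mulVec_smul, Matrix.mulVec_mulVec,
      Matrix.nonsing_inv_mul _ (isUnit_iff_ne_zero.mpr hG), Matrix.one_mulVec]
  have hb : ‖γ‖ * ‖WithLp.toLp 2 (block x l)‖ ≤ specNorm G⁻¹ * (K * ‖WithLp.toLp 2 x‖) := by
    calc ‖γ‖ * ‖WithLp.toLp 2 (block x l)‖ = ‖WithLp.toLp 2 (γ • block x l)‖ := by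
          rw [WithLp.toLp_smul, norm_smul]
      _ = ‖WithLp.toLp 2
            (G⁻¹ *ᵥ block (blockQ A μ (truncate Γ ((i : ℕ) - (l : ℕ))) *ᵥ x) i)‖ := by
          rw [hxl, WithLp.toLp_neg, norm_neg]
      _ ≤ specNorm G⁻¹ * ‖WithLp.toLp 2
            (block (blockQ A μ (truncate Γ ((i : ℕ) - (l : ℕ))) *ᵥ x) i)‖ :=
          norm_toLp_mulVec_le _ _
      _ ≤ specNorm G⁻¹ * (K * ‖WithLp.toLp 2 x‖) := by
          refine mul_le_mul_of_nonneg_left ?_ (specNorm_nonneg _)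
          refine (norm_toLp_block_le _ _).trans ?_
          exact ContinuousLinearMap.le_of_opNorm_le _ hK (WithLp.toLp 2 x)
  rw [hnorm, div_mul_eq_mul_div, le_div_iff₀ hγ0]
  calc ‖WithLp.toLp 2 (value A (μ l) *ᵥ block x l)‖ * ‖γ‖
      ≤ specNorm (value A (μ l)) * ‖WithLp.toLp 2 (block x l)‖ * ‖γ‖ := by
        gcongr
        exact norm_toLp_mulVec_le _ _
    _ = specNorm (value A (μ l)) * (‖γ‖ * ‖WithLp.toLp 2 (block x l)‖) := by ring
    _ ≤ specNorm (value A (μ l)) * (specNorm G⁻¹ * (K * ‖WithLp.toLp 2 x‖)) :=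
        mul_le_mul_of_nonneg_left hb (specNorm_nonneg _)
    _ = _ := by ring

/-- Superlevel sets of the objective at positive levels are bounded. -/
theorem exists_gam_bound (hn : 0 < n) (hr : 0 < r) (hrn : r ≤ n)
    (A : Fin (m + 1) → Matrix (Fin n) (Fin n) ℂ) (μ : Fin r → ℂ)
    (hG : ∀ k l : Fin r, k < l → (matDividedDiff A ![μ k, μ l]).det ≠ 0) {ε : ℝ} (hε : 0 < ε)
    (d : ℕ) : ∃ R : ℝ, 0 ≤ R ∧ ∀ Γ : Params r, ε ≤ objective A μ Γ →
      ∀ i l : Fin r, (i : ℕ) - (l : ℕ) < d → ‖gam Γ i l‖ ≤ R := by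
  induction d with
  | zero => exact ⟨0, le_rfl, fun Γ _ i l h => absurd h (Nat.not_lt_zero _)⟩
  | succ d ih =>
    obtain ⟨R, hR0, hR⟩ := ih
    have hcont : Continuous fun Γ : Params r =>
        ‖Matrix.toEuclideanCLM (n := Fin r × Fin n) (𝕜 := ℂ) (blockQ A μ Γ)‖ := by
      simp only [← kronQ_eq_blockQ]
      exact (continuous_toEuclideanCLM.comp (continuous_kronQ A μ)).norm
    -- By the induction hypothesis all relevant truncations lie in this ball, so `K` bounds their
    -- `Q` uniformly.
    obtain ⟨K, hK⟩ := (isCompact_closedBall (0 : Params r) R).bddAbove_image hcont.continuousOn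
    set c : Fin r × Fin r → ℝ := fun p => specNorm (value A (μ p.2)) *
      specNorm (matDividedDiff A ![μ p.2, μ p.1])⁻¹ * K / ε with hc
    refine ⟨R + ∑ p, |c p|, by positivity, fun Γ hΓ i l hil => ?_⟩
    have hsum : 0 ≤ ∑ p, |c p| := by positivity
    rcases (Nat.lt_succ_iff.mp hil).lt_or_eq with h1 | h1
    · linarith [hR Γ hΓ i l h1]
    by_cases hγ : gam Γ i l = 0
    · rw [hγ, norm_zero]
      positivity
    have hli : l < i := by
      by_contra hcon
      exact hγ (gam_eq_zero Γ hcon)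
    have htr : truncate Γ ((i : ℕ) - (l : ℕ)) ∈ Metric.closedBall (0 : Params r) R := by
      rw [mem_closedBall_zero_iff, pi_norm_le_iff_of_nonneg hR0]
      rintro ⟨⟨i', l'⟩, hp⟩
      simp only [truncate]
      split_ifs with h2
      · have h3 := hR Γ hΓ i' l' (by omega)
        simpa only [gam, dif_pos (show l' < i' from hp)] using h3
      · simpa using hR0
    have h4 := objective_mul_gam_le hn hr hrn A μ Γ hli (hG l i hli) hγ
      (hK (Set.mem_image_of_mem _ htr))
    have h5 : ‖gam Γ i l‖ ≤ c (i, l) := by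
      rw [hc, le_div_iff₀ hε, mul_comm]
      exact (mul_le_mul_of_nonneg_right hΓ (norm_nonneg _)).trans h4
    have h6 : |c (i, l)| ≤ ∑ p, |c p| :=
      Finset.single_le_sum (f := fun p => |c p|) (fun _ _ => abs_nonneg _) (Finset.mem_univ _)
    linarith [le_abs_self (c (i, l))]

/-- Either the objective is identically zero, or the superlevel set through a point of positive
value is bounded and continuity gives a maximum. -/
theorem exists_isOptimalParams (hn : 0 < n) (hr : 0 < r) (hrn : r ≤ n)
    (A : Fin (m + 1) → Matrix (Fin n) (Fin n) ℂ) (μ : Fin r → ℂ)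
    (hG : ∀ k l : Fin r, k < l → (matDividedDiff A ![μ k, μ l]).det ≠ 0) :
    ∃ Γ, IsOptimalParams A μ Γ := by
  by_cases h0 : ∀ Γ, objective A μ Γ ≤ 0
  · exact ⟨0, fun Γ => (h0 Γ).trans (objective_nonneg A μ 0)⟩
  push Not at h0
  obtain ⟨Γ₀, hΓ₀⟩ := h0
  obtain ⟨R, hR0, hR⟩ := exists_gam_bound hn hr hrn A μ hG hΓ₀ r
  have hmem : ∀ Γ, objective A μ Γ₀ ≤ objective A μ Γ →
      Γ ∈ Metric.closedBall (0 : Params r) R := by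
    intro Γ hΓ
    rw [mem_closedBall_zero_iff, pi_norm_le_iff_of_nonneg hR0]
    rintro ⟨⟨i, l⟩, hp⟩
    have h1 := hR Γ hΓ i l (by omega)
    simpa only [gam, dif_pos (show l < i from hp)] using h1
  obtain ⟨Γ, -, hmax⟩ := (isCompact_closedBall (0 : Params r) R).exists_isMaxOn
    ⟨Γ₀, hmem Γ₀ le_rfl⟩ (continuous_objective A μ).continuousOn
  refine ⟨Γ, fun Γ' => ?_⟩
  rcases le_total (objective A μ Γ₀) (objective A μ Γ') with h | h
  · exact hmax (hmem Γ' h)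
  · exact h.trans (hmax (hmem Γ₀ le_rfl))

theorem innerSup_eq_of_isOptimalParams {A : Fin (m + 1) → Matrix (Fin n) (Fin n) ℂ}
    {μ : Fin r → ℂ} {Γ : Params r} (h : IsOptimalParams A μ Γ) :
    innerSup A μ = ENNReal.ofReal (objective A μ Γ) :=
  le_antisymm (iSup_le fun Γ' => ENNReal.ofReal_le_ofReal (h Γ'))
    (le_iSup (fun Γ' => ENNReal.ofReal (objective A μ Γ')) Γ)

end MatPoly

end

/-! ### The block formula and the distance formula -/

theorem theorem3p3 {n m r : ℕ} (hm : 0 < m) (hr : 0 < r)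
    (A : Fin (m + 1) → Matrix (Fin n) (Fin n) ℂ) (hA : (A (Fin.last m)).rank = n)
    (S : Finset ℂ) :
    (∀ (μ : Fin r → ℂ) (Γ : MatPoly.Params r), MatPoly.kronQ A μ Γ = MatPoly.blockQ A μ Γ) ∧
    ∀ μ : Fin r → ℂ, MatPoly.IsOptimalNodes A S μ →
      ((n < r ∨ ∃ k l : Fin r, k < l ∧ (MatPoly.matDividedDiff A ![μ k, μ l]).rank < n) →
        ∃ Γ, MatPoly.IsOptimalParams A μ Γ) →
      ((∃ Γ, MatPoly.IsOptimalParams A μ Γ) →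
        ∃ Γ, MatPoly.IsOptimalParams A μ Γ ∧ MatPoly.MultiplicityAssumption A μ Γ ∧
          MatPoly.LinearIndependenceAssumption A μ Γ) →
      MatPoly.tau A S r =
        ⨅ ν ∈ MatPoly.tuples S r, ⨆ Γ : MatPoly.Params r,
          ENNReal.ofReal (MatPoly.svSmallest r (MatPoly.blockQ A ν Γ)) := by
  refine ⟨MatPoly.kronQ_eq_blockQ A, fun μ hμ hatt hgood => ?_⟩
  have hex : ∃ Γ, MatPoly.IsOptimalParams A μ Γ := by
    by_cases hc : n < r ∨ ∃ k l : Fin r, k < l ∧ (MatPoly.matDividedDiff A ![μ k, μ l]).rank < n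
    · exact hatt hc
    · push Not at hc
      refine MatPoly.exists_isOptimalParams (hr.trans_le hc.1) hr hc.1 A μ fun k l hkl => ?_
      apply Matrix.det_ne_zero_of_rank_eq
      refine le_antisymm (Matrix.rank_le_card_width _) ?_
      rw [Fintype.card_fin]
      exact hc.2 k l hkl
  obtain ⟨Γ, hopt, hmul, hlin⟩ := hgood hex
  -- An `n × r` matrix of rank `r` forces `r ≤ n`; in particular `n > 0`, as both bounds require.
  have hrn : r ≤ n := by
    obtain ⟨U, V, -, -, -, -, hV⟩ := hlin
    have := V.rank_le_card_height
    rwa [hV, Fintype.card_fin] at this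
  have hn : 0 < n := hr.trans_le hrn
  refine le_antisymm ?_ (MatPoly.iInf_innerSup_le_tau hm hn hr A hA S)
  refine (MatPoly.tau_le_objective hm hn hr A hA S hμ.1 hopt hmul hlin).trans ?_
  rw [← MatPoly.innerSup_eq_of_isOptimalParams hopt]
  exact le_iInf₂ hμ.2
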